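/- **Theorem.** Let $\varepsilon>0$. There is an algorithm $P$ (a program for the unit-cost random access machine with addition and truncated subtraction) that takes as input a finite graph $G$, given by its adjacency matrix, and an integer $k\ge 0$, and has the following property. For every fixed $k$ there is a polynomial $p$ such that, for every unit disk graph $G$ with $n$ vertices, $P$ halts on $(G,k)$ after at most $p(n)$ steps, and, if $G$ has a $k$-tuple dominating set, its output is a $k$-tuple dominating set of $G$ of cardinality at most $(1+\varepsilon)\,\gamma_k(G)$. Here $G=(V,E)$ is a unit disk graph if there are points $c_v\in\mathbb R^2$ ($v\in V$) such that distinct vertices $u,v$ are adjacent if and only if $\|c_u-c_v\|\le 1$; a set $D\subseteq V$ is a $k$-tuple dominating set if $|N[v]\cap D|\ge k$ for every $v\in V$, where $N[v]$ consists of $v$ and its neighbours; and $\gamma_k(G)$ is the minimum cardinality of a $k$-tuple dominating set. The points $c_v$ are not part of the input. -/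

import Mathlib

/-! ### Unit disk graphs and k-tuple dominating sets -/

/-- `G` is a unit disk graph: its vertices can be placed in the Euclidean plane so that two
distinct vertices are adjacent iff the closed unit disks centred at them contain each other's
centres. (Two vertices may be placed at the same point.) -/
def SimpleGraph.IsUnitDiskGraph {V : Type*} (G : SimpleGraph V) : Prop :=
  ∃ c : V → EuclideanSpace ℝ (Fin 2),
    ∀ u v, G.Adj u v ↔ u ≠ v ∧ c u ∈ Metric.closedBall (c v) 1

open Classical in
/-- `D` is a `k`-tuple dominating set of `G`: the closed neighbourhood of every vertex contains
at least `k` elements of `D`. -/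
def SimpleGraph.IsTupleDominating {V : Type*} (G : SimpleGraph V) (k : ℕ) (D : Finset V) : Prop :=
  ∀ v, k ≤ (D.filter fun u => u = v ∨ G.Adj v u).card

/-- `D` is a `k`-tuple dominating set of `G` of minimum cardinality. -/
def SimpleGraph.IsMinTupleDominating {V : Type*} (G : SimpleGraph V) (k : ℕ) (D : Finset V) :
    Prop :=
  G.IsTupleDominating k D ∧ ∀ D' : Finset V, G.IsTupleDominating k D' → D.card ≤ D'.card

/-! ### Random access machines

The cost model is the unit-cost random access machine with addition and (truncated) subtraction
and without multiplication, programmed by structured programs. It has registers and arrays of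
natural numbers; a program mentions finitely many of them. -/

namespace RAM

/-- The contents of the registers and of the arrays. -/
structure State where
  reg : ℕ → ℕ
  arr : ℕ → ℕ → ℕ

/-- Expressions: constants, registers, array entries `a[i]`, sums and truncated differences. -/
inductive Expr
  | const (c : ℕ)
  | reg (x : ℕ)
  | get (a : ℕ) (i : Expr)
  | add (e f : Expr)
  | sub (e f : Expr)

/-- The value of an expression. -/
def Expr.eval (s : State) : Expr → ℕ
  | const c => c
  | reg x => s.reg x
  | get a i => s.arr a (i.eval s)
  | add e f => e.eval s + f.eval s
  | sub e f => e.eval s - f.eval s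

/-- The number of steps needed to evaluate an expression: one for each node. -/
def Expr.cost : Expr → ℕ
  | const _ => 1
  | reg _ => 1
  | get _ i => i.cost + 1
  | add e f => e.cost + f.cost + 1
  | sub e f => e.cost + f.cost + 1

/-- Programs: `x := e`, `a[i] := e`, composition, branching on `e ≠ 0`, and looping while
`e ≠ 0`. -/
inductive Prog
  | skip
  | assign (x : ℕ) (e : Expr)
  | store (a : ℕ) (i e : Expr)
  | seq (p q : Prog)
  | cond (e : Expr) (p q : Prog)
  | loop (e : Expr) (p : Prog)

/-- `Run p s t s'`: started in the state `s`, the program `p` halts after exactly `t` steps in the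
state `s'`. -/
inductive Run : Prog → State → ℕ → State → Prop
  | skip (s : State) : Run .skip s 1 s
  | assign (x : ℕ) (e : Expr) (s : State) :
      Run (.assign x e) s (e.cost + 1) { s with reg := Function.update s.reg x (e.eval s) }
  | store (a : ℕ) (i e : Expr) (s : State) :
      Run (.store a i e) s (i.cost + e.cost + 1)
        { s with arr := Function.update s.arr a
                          (Function.update (s.arr a) (i.eval s) (e.eval s)) }
  | seq {p q : Prog} {s s' s'' : State} {t t' : ℕ} (hp : Run p s t s') (hq : Run q s' t' s'') :
      Run (.seq p q) s (t + t') s''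
  | cond_pos {e : Expr} {p q : Prog} {s s' : State} {t : ℕ} (he : e.eval s ≠ 0)
      (hp : Run p s t s') : Run (.cond e p q) s (e.cost + 1 + t) s'
  | cond_neg {e : Expr} {p q : Prog} {s s' : State} {t : ℕ} (he : e.eval s = 0)
      (hq : Run q s t s') : Run (.cond e p q) s (e.cost + 1 + t) s'
  | loop_pos {e : Expr} {p : Prog} {s s' s'' : State} {t t' : ℕ} (he : e.eval s ≠ 0)
      (hp : Run p s t s') (hl : Run (.loop e p) s' t' s'') :
      Run (.loop e p) s (e.cost + 1 + t + t') s''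
  | loop_neg {e : Expr} {p : Prog} {s : State} (he : e.eval s = 0) :
      Run (.loop e p) s (e.cost + 1) s

open Classical in
/-- The initial state on the input `(G, k)`, where `G` has the vertices `0, …, n - 1`: register 0
holds `n`, register 1 holds `k`, array 0 holds the adjacency matrix of `G` row by row (the entry
in row `u` and column `v` at position `u * n + v`), everything else is 0. -/
noncomputable def input {n : ℕ} (G : SimpleGraph (Fin n)) (k : ℕ) : State where
  reg x := if x = 0 then n else if x = 1 then k else 0
  arr a i := if a = 0 ∧ ∃ u v : Fin n, i = (u : ℕ) * n + (v : ℕ) ∧ G.Adj u v then 1 else 0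

/-- The set of vertices that a state holds as output: those whose entry in array 1 is 1. -/
def output (n : ℕ) (s : State) : Finset (Fin n) :=
  Finset.univ.filter fun v => s.arr 1 v = 1

end RAM

/-! The algorithm is local and never sees the points, which serve only to bound its running time.
For a set W of vertices let γ(W) be the least size of a set, anywhere in G, that has at least k
elements in the closed neighbourhood of each vertex of W. Starting from {v}, where v is not yet
removed, W is replaced repeatedly by the set W' of unremoved vertices near W (closed neighbourhoods
meet), until q γ(W') ≤ (q + 1) γ(W). A minimum cover of W' joins the output, and W' is removed.

Ratio: every unremoved vertex near the final W is removed with it, so the final sets W of different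
rounds are pairwise not near. A cover of their union splits into disjoint covers of the pieces
(`Covers.coverNumber_add_le`), so their cover numbers add up to at most that of G, and the output
exceeds the optimum by at most the factor 1 + 1/q (`Progress.union`).

Time: after j growth steps W lies in a disk of radius 2j. Small squares cut it into O(j²) cliques,
each covered by k² vertices (`Covers.coverNumber_le_of_dist`), while every growth step that fails
the stopping test multiplies γ by more than (q + 1)/q. So growth stops within J rounds, with J
depending only on q and k. All covers sought then have bounded size, and running through all vertex
tuples by increasing length takes polynomial time (`Rep.halts_search`).

For the machine, expressions with bounded sums are compiled once and for all with a polynomial time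
bound, so that each graph-theoretic test is a single formula; `Rep` links machine states with the
sets. -/

namespace RAM

/-! ### A program logic with running times -/

/-- The state `s` with the register `x` set to `v`. -/
def State.setReg (s : State) (x v : ℕ) : State := { s with reg := Function.update s.reg x v }

/-- The state `s` with the array entry `a[i]` set to `v`. -/
def State.setArr (s : State) (a i v : ℕ) : State :=
  { s with arr := Function.update s.arr a (Function.update (s.arr a) i v) }

@[simp] theorem State.setReg_arr (s : State) (x v : ℕ) : (s.setReg x v).arr = s.arr := rfl

@[simp] theorem State.setReg_reg (s : State) (x v y : ℕ) :
    (s.setReg x v).reg y = if y = x then v else s.reg y := by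
  simp [State.setReg, Function.update_apply]

@[simp] theorem State.setArr_reg (s : State) (a i v : ℕ) : (s.setArr a i v).reg = s.reg := rfl

theorem State.setArr_arr (s : State) (a i v b j : ℕ) :
    (s.setArr a i v).arr b j = if b = a ∧ j = i then v else s.arr b j := by
  by_cases hb : b = a
  · subst hb; simp [State.setArr, Function.update_apply]
  · simp [State.setArr, hb]

/-- Started in `s`, the program `c` halts after at most `T` steps in a state satisfying `Q`. -/
def Halts (c : Prog) (s : State) (T : ℕ) (Q : State → Prop) : Prop :=
  ∃ t s', Run c s t s' ∧ t ≤ T ∧ Q s'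

theorem Halts.mono {c : Prog} {s : State} {T T' : ℕ} {Q Q' : State → Prop} (h : Halts c s T Q)
    (hT : T ≤ T') (hQ : ∀ s', Q s' → Q' s') : Halts c s T' Q' := by
  obtain ⟨t, s', hr, ht, hq⟩ := h
  exact ⟨t, s', hr, ht.trans hT, hQ _ hq⟩

theorem Halts.skip {s : State} {Q : State → Prop} (h : Q s) : Halts .skip s 1 Q :=
  ⟨1, s, .skip s, le_rfl, h⟩

theorem Halts.assign {s : State} {Q : State → Prop} {x : ℕ} {e : Expr}
    (h : Q (s.setReg x (e.eval s))) : Halts (.assign x e) s (e.cost + 1) Q :=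
  ⟨_, _, .assign x e s, le_rfl, h⟩

theorem Halts.store {s : State} {Q : State → Prop} {a : ℕ} {i e : Expr}
    (h : Q (s.setArr a (i.eval s) (e.eval s))) :
    Halts (.store a i e) s (i.cost + e.cost + 1) Q :=
  ⟨_, _, .store a i e s, le_rfl, h⟩

theorem Halts.seq {p q : Prog} {s : State} {T T' : ℕ} {Q : State → Prop}
    (h : Halts p s T fun s' => Halts q s' T' Q) : Halts (.seq p q) s (T + T') Q := by
  obtain ⟨t, s', hr, ht, t', s'', hr', ht', hq⟩ := h
  exact ⟨_, _, .seq hr hr', by omega, hq⟩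

theorem Halts.cond {p q : Prog} {s : State} {T : ℕ} {Q : State → Prop} {e : Expr}
    (hp : e.eval s ≠ 0 → Halts p s T Q) (hq : e.eval s = 0 → Halts q s T Q) :
    Halts (.cond e p q) s (e.cost + 1 + T) Q := by
  by_cases he : e.eval s = 0
  · obtain ⟨t, s', hr, ht, h⟩ := hq he
    exact ⟨_, _, .cond_neg he hr, by omega, h⟩
  · obtain ⟨t, s', hr, ht, h⟩ := hp he
    exact ⟨_, _, .cond_pos he hr, by omega, h⟩

theorem Halts.loop_exit {p : Prog} {e : Expr} {s : State} {Q : State → Prop} (he : e.eval s = 0)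
    (h : Q s) : Halts (.loop e p) s (e.cost + 1) Q :=
  ⟨_, _, .loop_neg he, le_rfl, h⟩

theorem Halts.loop_step {p : Prog} {e : Expr} {s : State} {T T' : ℕ} {Q : State → Prop}
    (he : e.eval s ≠ 0) (h : Halts p s T fun s' => Halts (.loop e p) s' T' Q) :
    Halts (.loop e p) s (e.cost + 1 + T + T') Q := by
  obtain ⟨t, s', hr, ht, t', s'', hr', ht', hq⟩ := h
  exact ⟨_, _, .loop_pos he hr hr', by omega, hq⟩

/-- The rule for loops: `I m` holds when at most `m` more rounds are to come. -/
theorem Halts.loop {p : Prog} {e : Expr} {T : ℕ} {I : ℕ → State → Prop}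
    (h0 : ∀ s, I 0 s → e.eval s = 0)
    (hs : ∀ m s, I (m + 1) s → e.eval s ≠ 0 → Halts p s T (I m)) (m : ℕ) :
    ∀ s, I m s → Halts (.loop e p) s (m * (e.cost + 1 + T) + (e.cost + 1))
      (fun s' => (∃ m', m' ≤ m ∧ I m' s') ∧ e.eval s' = 0) := by
  induction m with
  | zero =>
    intro s hI
    rw [Nat.zero_mul, Nat.zero_add]
    exact Halts.loop_exit (h0 s hI) ⟨⟨0, le_rfl, hI⟩, h0 s hI⟩
  | succ m ih =>
    intro s hI
    by_cases he : e.eval s = 0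
    · refine (Halts.loop_exit he ?_).mono (Nat.le_add_left _ _) (fun _ h => h)
      exact ⟨⟨_, le_rfl, hI⟩, he⟩
    · refine (Halts.loop_step he ((hs m s hI he).mono le_rfl ih)).mono
        (by rw [Nat.succ_mul]; omega) ?_
      rintro s' ⟨⟨m', hm', h'⟩, h''⟩
      exact ⟨⟨m', by omega, h'⟩, h''⟩

/-- `for x = 0, …, n - 1 do p`, where `n` is the content of register 0. -/
def forLoop (x : ℕ) (p : Prog) : Prog :=
  .seq (.assign x (.const 0))
    (.loop (.sub (.reg 0) (.reg x)) (.seq p (.assign x (.add (.reg x) (.const 1)))))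

/-- The body has to leave the counter as it found it. Each round pays 4 for the test and 4 for the
increment; the final 6 is the initialisation and the last test. -/
theorem Halts.forLoop {x : ℕ} {p : Prog} {n T : ℕ} {I : ℕ → State → Prop} {s : State}
    (hI : ∀ i s, I i s → s.reg x = i ∧ s.reg 0 = n) (h0 : I 0 (s.setReg x 0))
    (hs : ∀ i s, i < n → I i s →
      Halts p s T fun s' => s'.reg x = i ∧ I (i + 1) (s'.setReg x (i + 1))) :
    Halts (forLoop x p) s (n * (T + 8) + 6) (I n) := by
  have key := Halts.loop (p := .seq p (.assign x (.add (.reg x) (.const 1))))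
    (e := .sub (.reg 0) (.reg x)) (T := T + 4) (I := fun m s => ∃ i, m + i = n ∧ I i s) ?_ ?_ n
    (s.setReg x 0) ⟨0, by simp, h0⟩
  · refine (Halts.seq (T := 2) (T' := n * (T + 8) + 4) ?_).mono (by omega) (fun s' h => h)
    refine Halts.assign ?_
    refine key.mono ?_ ?_
    · simp only [Expr.cost]
      exact Nat.add_le_add_right (Nat.mul_le_mul_left _ (by omega)) _
    · rintro s' ⟨⟨m, _, i, hmi, hi⟩, he⟩
      obtain ⟨h1, h2⟩ := hI i s' hi
      simp only [Expr.eval, h1, h2] at he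
      obtain rfl : i = n := by omega
      exact hi
  · rintro s' ⟨i, hmi, hi⟩
    obtain ⟨h1, h2⟩ := hI i s' hi
    simp only [Expr.eval, h1, h2]; omega
  · rintro m s' ⟨i, hmi, hi⟩ -
    refine Halts.seq ?_
    refine (hs i s' (by omega) hi).mono le_rfl ?_
    rintro s'' ⟨hx, h⟩
    refine Halts.assign ?_
    refine ⟨i + 1, by omega, ?_⟩
    simpa [Expr.eval, hx] using h

/-! ### Expressions with bounded sums -/

/-- Expressions with sums over the numbers below the content of register 0. -/
inductive BExpr
  | const (c : ℕ)
  | reg (x : ℕ)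
  | var (i : ℕ)
  | get (a : ℕ) (e : BExpr)
  | add (e f : BExpr)
  | sub (e f : BExpr)
  | sum (i : ℕ) (e : BExpr)

namespace BExpr

/-- The value of an expression, where `env` gives the values of the variables. -/
def eval (s : State) (env : ℕ → ℕ) : BExpr → ℕ
  | const c => c
  | reg x => s.reg x
  | var i => env i
  | get a e => s.arr a (e.eval s env)
  | add e f => e.eval s env + f.eval s env
  | sub e f => e.eval s env - f.eval s env
  | sum i e => ∑ j ∈ Finset.range (s.reg 0), e.eval s (Function.update env i j)

/-- The free variables are below `m`, the variable bound by a sum is the number of variables in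
its scope, and only the registers below 16 are read. -/
def WF (m : ℕ) : BExpr → Prop
  | const _ => True
  | reg x => x < 16
  | var i => i < m
  | get _ e => e.WF m
  | add e f => e.WF m ∧ f.WF m
  | sub e f => e.WF m ∧ f.WF m
  | sum i e => i = m ∧ e.WF (m + 1)

/-- The array `a` is not read. -/
def Avoids (a : ℕ) : BExpr → Prop
  | const _ => True
  | reg _ => True
  | var _ => True
  | get b e => b ≠ a ∧ e.Avoids a
  | add e f => e.Avoids a ∧ f.Avoids a
  | sub e f => e.Avoids a ∧ f.Avoids a
  | sum _ e => e.Avoids a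

/-- A bound for the running time of the compiled expression. -/
def time (n : ℕ) : BExpr → ℕ
  | const _ => 2
  | reg _ => 2
  | var _ => 2
  | get _ e => e.time n + 3
  | add e f => e.time n + f.time n + 4
  | sub e f => e.time n + f.time n + 4
  | sum _ e => n * (e.time n + 12) + 8

/-- The compiled expression: temporary results are kept in the registers `16 + 2 * d`, the
variables in the registers `17 + 2 * i`. -/
def compile : BExpr → ℕ → Prog
  | const c, d => .assign (16 + 2 * d) (.const c)
  | reg x, d => .assign (16 + 2 * d) (.reg x)
  | var i, d => .assign (16 + 2 * d) (.reg (17 + 2 * i))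
  | get a e, d => .seq (e.compile d) (.assign (16 + 2 * d) (.get a (.reg (16 + 2 * d))))
  | add e f, d => .seq (e.compile d) (.seq (f.compile (d + 1))
      (.assign (16 + 2 * d) (.add (.reg (16 + 2 * d)) (.reg (16 + 2 * (d + 1))))))
  | sub e f, d => .seq (e.compile d) (.seq (f.compile (d + 1))
      (.assign (16 + 2 * d) (.sub (.reg (16 + 2 * d)) (.reg (16 + 2 * (d + 1))))))
  | sum i e, d => .seq (.assign (16 + 2 * d) (.const 0)) (forLoop (17 + 2 * i)
      (.seq (e.compile (d + 1))
        (.assign (16 + 2 * d) (.add (.reg (16 + 2 * d)) (.reg (16 + 2 * (d + 1)))))))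

/-- A sum in the scope of `m` variables binds the variable `m`, so later variables are always bound
before they are read. Together with the restriction to registers below 16 this makes values immune
to the scratch work of compiled code. -/
theorem eval_congr {s s' : State} (e : BExpr) : ∀ (m : ℕ) (env env' : ℕ → ℕ), e.WF m →
    (∀ x < 16, s'.reg x = s.reg x) → (∀ i < m, env' i = env i) →
    (∀ a, e.Avoids a ∨ s'.arr a = s.arr a) → e.eval s' env' = e.eval s env := by
  induction e with
  | const c => intros; rfl
  | reg x => intro m env env' hw hr _ _; exact hr x hw
  | var i => intro m env env' hw _ he _; exact he i hw
  | get a e ih =>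
    intro m env env' hw hr he ha
    have h1 : s'.arr a = s.arr a := (ha a).resolve_left (fun h => h.1 rfl)
    simp only [eval, h1]
    rw [ih m env env' hw hr he (fun a => (ha a).imp_left (·.2))]
  | add e f ihe ihf =>
    intro m env env' hw hr he ha
    simp only [eval]
    rw [ihe m env env' hw.1 hr he (fun a => (ha a).imp_left (·.1)),
      ihf m env env' hw.2 hr he (fun a => (ha a).imp_left (·.2))]
  | sub e f ihe ihf =>
    intro m env env' hw hr he ha
    simp only [eval]
    rw [ihe m env env' hw.1 hr he (fun a => (ha a).imp_left (·.1)),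
      ihf m env env' hw.2 hr he (fun a => (ha a).imp_left (·.2))]
  | sum i e ih =>
    intro m env env' hw hr he ha
    obtain ⟨rfl, hw⟩ := hw
    simp only [eval, hr 0 (by omega)]
    refine Finset.sum_congr rfl fun j _ => ih (i + 1) _ _ hw hr (fun l hl => ?_) ha
    by_cases h : l = i
    · simp [h]
    · simp [h, he l (by omega)]

/-- The states `s` and `s'` agree but for the temporary registers from the `d`-th one on and the
variables from the `m`-th one on. -/
structure Agree (d m : ℕ) (s s' : State) : Prop where
  arr : s'.arr = s.arr
  reg : ∀ x < 16, s'.reg x = s.reg x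
  tmp : ∀ i < d, s'.reg (16 + 2 * i) = s.reg (16 + 2 * i)
  var : ∀ i < m, s'.reg (17 + 2 * i) = s.reg (17 + 2 * i)

theorem Agree.refl (d m : ℕ) (s : State) : Agree d m s s :=
  ⟨rfl, fun _ _ => rfl, fun _ _ => rfl, fun _ _ => rfl⟩

theorem Agree.trans {d m : ℕ} {s s' s'' : State} (h : Agree d m s s') (h' : Agree d m s' s'') :
    Agree d m s s'' :=
  ⟨h'.arr.trans h.arr, fun x hx => (h'.reg x hx).trans (h.reg x hx),
    fun x hx => (h'.tmp x hx).trans (h.tmp x hx), fun x hx => (h'.var x hx).trans (h.var x hx)⟩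

theorem Agree.mono {d d' m m' : ℕ} {s s' : State} (h : Agree d m s s') (hd : d' ≤ d)
    (hm : m' ≤ m) : Agree d' m' s s' :=
  ⟨h.arr, h.reg, fun x hx => h.tmp x (by omega), fun x hx => h.var x (by omega)⟩

theorem Agree.setTmp {d m : ℕ} {s s' : State} (h : Agree d m s s') (v : ℕ) :
    Agree d m s (s'.setReg (16 + 2 * d) v) := by
  refine ⟨h.arr, fun x hx => ?_, fun x hx => ?_, fun x hx => ?_⟩
  · rw [State.setReg_reg, if_neg (by omega)]; exact h.reg x hx
  · rw [State.setReg_reg, if_neg (by omega)]; exact h.tmp x hx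
  · rw [State.setReg_reg, if_neg (by omega)]; exact h.var x hx

theorem Agree.setVar {d m : ℕ} {s s' : State} (h : Agree d m s s') (v : ℕ) :
    Agree d m s (s'.setReg (17 + 2 * m) v) := by
  refine ⟨h.arr, fun x hx => ?_, fun x hx => ?_, fun x hx => ?_⟩
  · rw [State.setReg_reg, if_neg (by omega)]; exact h.reg x hx
  · rw [State.setReg_reg, if_neg (by omega)]; exact h.tmp x hx
  · rw [State.setReg_reg, if_neg (by omega)]; exact h.var x hx

/-- The right operand is compiled at depth `d + 1`, so the left value in temporary register `d`
survives. Likewise a sum's counter survives its body, which sees one more variable. Even and odd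
registers keep the two kinds apart. -/
theorem compile_correct (e : BExpr) : ∀ (d m : ℕ) (s : State) (env : ℕ → ℕ), e.WF m →
    (∀ i < m, s.reg (17 + 2 * i) = env i) →
    Halts (e.compile d) s (e.time (s.reg 0)) fun s' =>
      Agree d m s s' ∧ s'.reg (16 + 2 * d) = e.eval s env := by
  induction e with
  | const c =>
    intro d m s env _ _
    exact Halts.assign ⟨(Agree.refl d m s).setTmp _, by simp [Expr.eval, eval]⟩
  | reg x =>
    intro d m s env _ _
    exact Halts.assign ⟨(Agree.refl d m s).setTmp _, by simp [Expr.eval, eval]⟩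
  | var i =>
    intro d m s env hw he
    exact Halts.assign ⟨(Agree.refl d m s).setTmp _, by simp [Expr.eval, eval, he i hw]⟩
  | get a e ih =>
    intro d m s env hw he
    refine Halts.seq (T' := 3) ((ih d m s env hw he).mono le_rfl ?_)
    rintro s' ⟨h, hv⟩
    exact Halts.assign ⟨h.setTmp _, by simp [Expr.eval, eval, hv, h.arr]⟩
  | add e f ihe ihf =>
    intro d m s env hw he
    refine (Halts.seq (T' := f.time (s.reg 0) + 4) ((ihe d m s env hw.1 he).mono le_rfl ?_)).mono
      (by simp only [time]; omega) (fun _ h => h)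
    rintro s' ⟨h, hv⟩
    refine Halts.seq ?_
    rw [← h.reg 0 (by omega)]
    refine (ihf (d + 1) m s' env hw.2 fun i hi => (h.var i hi).trans (he i hi)).mono le_rfl ?_
    rintro s'' ⟨h', hv'⟩
    refine Halts.assign ⟨(h.trans (h'.mono (by omega) le_rfl)).setTmp _, ?_⟩
    rw [eval_congr f m env env hw.2 h.reg (fun _ _ => rfl) (fun a => .inr (by rw [h.arr]))] at hv'
    simp [Expr.eval, eval, hv', h'.tmp d (by omega), hv]
  | sub e f ihe ihf =>
    intro d m s env hw he
    refine (Halts.seq (T' := f.time (s.reg 0) + 4) ((ihe d m s env hw.1 he).mono le_rfl ?_)).mono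
      (by simp only [time]; omega) (fun _ h => h)
    rintro s' ⟨h, hv⟩
    refine Halts.seq ?_
    rw [← h.reg 0 (by omega)]
    refine (ihf (d + 1) m s' env hw.2 fun i hi => (h.var i hi).trans (he i hi)).mono le_rfl ?_
    rintro s'' ⟨h', hv'⟩
    refine Halts.assign ⟨(h.trans (h'.mono (by omega) le_rfl)).setTmp _, ?_⟩
    rw [eval_congr f m env env hw.2 h.reg (fun _ _ => rfl) (fun a => .inr (by rw [h.arr]))] at hv'
    simp [Expr.eval, eval, hv', h'.tmp d (by omega), hv]
  | sum i e ih =>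
    intro d m s env hw he
    obtain ⟨rfl, hw⟩ := hw
    refine (Halts.seq (T := 2) (T' := s.reg 0 * (e.time (s.reg 0) + 4 + 8) + 6) ?_).mono
      (by
        change 2 + (s.reg 0 * (e.time (s.reg 0) + 12) + 6) ≤ s.reg 0 * (e.time (s.reg 0) + 12) + 8
        omega) (fun _ h => h)
    refine Halts.assign ?_
    refine (Halts.forLoop (n := s.reg 0) (I := fun j s' => s'.reg (17 + 2 * i) = j ∧
      Agree d i s s' ∧ s'.reg (16 + 2 * d) =
        ∑ l ∈ Finset.range j, e.eval s (Function.update env i l)) ?_ ?_ ?_).mono le_rfl ?_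
    · rintro j s' ⟨h1, h2, -⟩
      exact ⟨h1, h2.reg 0 (by omega)⟩
    · refine ⟨by simp, ((Agree.refl d i s).setTmp _).setVar _, ?_⟩
      simp [Expr.eval, show 16 + 2 * d ≠ 17 + 2 * i by omega]
    · rintro j s' hj ⟨h1, h2, h3⟩
      refine Halts.seq ?_
      rw [← h2.reg 0 (by omega)]
      refine (ih (d + 1) (i + 1) s' (Function.update env i j) hw fun l hl => ?_).mono le_rfl ?_
      · by_cases h : l = i
        · simp [h, h1]
        · simp only [Function.update_apply, if_neg h]
          exact (h2.var l (by omega)).trans (he l (by omega))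
      · rintro s'' ⟨h', hv'⟩
        have hv : e.eval s' (Function.update env i j) = e.eval s (Function.update env i j) :=
          eval_congr e (i + 1) _ _ hw h2.reg (fun _ _ => rfl) (fun a => .inr (by rw [h2.arr]))
        refine Halts.assign ⟨?_, by simp, ?_, ?_⟩
        · rw [State.setReg_reg, if_neg (by omega), h'.var i (by omega), h1]
        · exact ((h2.trans (h'.mono (by omega) (by omega))).setTmp _).setVar _
        · simp [Expr.eval, show 16 + 2 * d ≠ 17 + 2 * i by omega, hv', h'.tmp d (by omega), h3,
            Finset.sum_range_succ, hv]
    · rintro s' ⟨-, h2, h3⟩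
      exact ⟨h2, h3⟩

end BExpr

/-! ### Assigning expressions to registers and arrays -/

/-- The states `s` and `s'` agree on the arrays and on the registers below 16. -/
def Same (s s' : State) : Prop := s'.arr = s.arr ∧ ∀ x < 16, s'.reg x = s.reg x

/-- `x := e` -/
def assignB (x : ℕ) (e : BExpr) : Prog := .seq (e.compile 0) (.assign x (.reg 16))

theorem Halts.assignB {x : ℕ} {e : BExpr} {s : State} {Q : State → Prop} (hw : e.WF 0)
    (h : ∀ s', Same s s' → Q (s'.setReg x (e.eval s 0))) :
    Halts (assignB x e) s (e.time (s.reg 0) + 2) Q := by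
  refine Halts.seq ((e.compile_correct 0 0 s 0 hw (by simp)).mono le_rfl ?_)
  rintro s' ⟨h1, h2⟩
  refine Halts.assign ?_
  have := h s' ⟨h1.arr, h1.reg⟩
  rwa [← h2] at this

/-- `a[x] := e` for all `x` below the content of register 0; in `e`, `x` is the variable 0. -/
def fill (a : ℕ) (e : BExpr) : Prog :=
  forLoop 17 (.seq (e.compile 0) (.store a (.reg 17) (.reg 16)))

/-- `s'` is `s` but for the registers from 16 on and the array `a`, where the entries below `n` are
given by `f`. -/
structure Filled (a n : ℕ) (f : ℕ → ℕ) (s s' : State) : Prop where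
  reg : ∀ x < 16, s'.reg x = s.reg x
  arr : ∀ b ≠ a, s'.arr b = s.arr b
  val : ∀ i, s'.arr a i = if i < n then f i else s.arr a i

/-- Entries are overwritten while `e` is still to be evaluated for later indices, hence `e` must not
read `a`. -/
theorem Halts.fill {a : ℕ} {e : BExpr} {s : State} (hw : e.WF 1) (ha : e.Avoids a) :
    Halts (fill a e) s (s.reg 0 * (e.time (s.reg 0) + 11) + 6)
      (Filled a (s.reg 0) (fun i => e.eval s fun _ => i) s) := by
  refine (Halts.forLoop (T := e.time (s.reg 0) + 3) (n := s.reg 0)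
    (I := fun j s' => s'.reg 17 = j ∧
      Filled a j (fun i => e.eval s fun _ => i) s s') ?_ ?_ ?_).mono le_rfl ?_
  · rintro j s' ⟨h1, h2⟩
    exact ⟨h1, h2.reg 0 (by omega)⟩
  · refine ⟨by simp, fun x hx => ?_, fun _ _ => rfl, fun i => by simp⟩
    rw [State.setReg_reg, if_neg (by omega)]
  · rintro j s' hj ⟨h1, h2⟩
    refine Halts.seq ?_
    rw [← h2.reg 0 (by omega)]
    refine (e.compile_correct 0 1 s' (fun _ => j) hw fun i hi => ?_).mono le_rfl ?_
    · obtain rfl : i = 0 := by omega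
      exact h1
    rintro s'' ⟨h', hv'⟩
    have h17 : s''.reg 17 = j := (h'.var 0 (by omega)).trans h1
    have hv : e.eval s' (fun _ => j) = e.eval s (fun _ => j) :=
      e.eval_congr 1 _ _ hw h2.reg (fun _ _ => rfl) (fun b => by
        by_cases hb : b = a
        · exact .inl (hb ▸ ha)
        · exact .inr (h2.arr b hb))
    refine Halts.store ⟨h17, by simp, fun x hx => ?_, fun b hb => ?_, fun i => ?_⟩
    · rw [State.setReg_reg, if_neg (by omega)]
      exact (h'.reg x hx).trans (h2.reg x hx)
    · funext i
      rw [State.setReg_arr, State.setArr_arr, if_neg (by tauto), h'.arr, h2.arr b hb]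
    · rw [State.setReg_arr, State.setArr_arr]
      simp only [Expr.eval, h17, true_and]
      rw [hv', hv, h'.arr, h2.val i]
      by_cases hi : i = j
      · simp [hi]
      · simp only [if_neg hi]
        exact if_congr (by omega) rfl rfl
  · rintro s' ⟨-, h⟩
    exact h

/-- `a[x] := e` for all `x` below the content of register 0, by way of the array 4. -/
def fillVia (a : ℕ) (e : BExpr) : Prog := .seq (fill 4 e) (fill a (.get 4 (.var 0)))

/-- The detour through a scratch array allows `e` to read the array it replaces, as `growE`, `outE`
and `remE` do. -/
theorem Halts.fillVia {a : ℕ} {e : BExpr} {s : State} {Q : State → Prop} (hw : e.WF 1)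
    (ha : e.Avoids 4) (ha4 : a ≠ 4)
    (h : ∀ s', (∀ x < 16, s'.reg x = s.reg x) → (∀ b ≠ a, b ≠ 4 → s'.arr b = s.arr b) →
      (∀ i, s'.arr a i = if i < s.reg 0 then e.eval s (fun _ => i) else s.arr a i) → Q s') :
    Halts (fillVia a e) s (s.reg 0 * (e.time (s.reg 0) + 27) + 12) Q := by
  refine (Halts.seq (T' := s.reg 0 * 16 + 6) ((Halts.fill hw ha).mono le_rfl ?_)).mono
    (by ring_nf; omega) (fun _ h => h)
  intro s' h1
  have := Halts.fill (a := a) (e := .get 4 (.var 0)) (s := s') (by simp [BExpr.WF])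
    (by simp [BExpr.Avoids, ha4.symm])
  rw [h1.reg 0 (by omega)] at this
  refine this.mono (by simp [BExpr.time]) ?_
  intro s'' h2
  refine h s'' (fun x hx => (h2.reg x hx).trans (h1.reg x hx))
    (fun b hb hb4 => (h2.arr b hb).trans (h1.arr b hb4)) fun i => ?_
  rw [h2.val i]
  simp only [BExpr.eval, h1.val, h1.arr a ha4]
  split_ifs <;> rfl

end RAM

/-! ### Cover numbers and the geometry of unit disk graphs -/

namespace SimpleGraph

variable {V : Type*} {G : SimpleGraph V} {k : ℕ}

open Classical in
/-- Every vertex of `W` has at least `k` elements of `D` in its closed neighbourhood. -/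
def Covers (G : SimpleGraph V) (k : ℕ) (D W : Finset V) : Prop :=
  ∀ v ∈ W, k ≤ (D.filter fun u => u = v ∨ G.Adj v u).card

theorem isTupleDominating_iff_covers [Fintype V] {D : Finset V} :
    G.IsTupleDominating k D ↔ G.Covers k D Finset.univ := by
  simp [IsTupleDominating, Covers]

open Classical in
theorem Covers.mono {D D' W W' : Finset V} (h : G.Covers k D W) (hD : D ⊆ D') (hW : W' ⊆ W) :
    G.Covers k D' W' := fun v hv =>
  (h v (hW hv)).trans (Finset.card_le_card (Finset.filter_subset_filter _ hD))

theorem Covers.union [DecidableEq V] {D D' W W' : Finset V} (h : G.Covers k D W)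
    (h' : G.Covers k D' W') : G.Covers k (D ∪ D') (W ∪ W') := by
  intro v hv
  rcases Finset.mem_union.1 hv with hv | hv
  · exact (h.mono Finset.subset_union_left le_rfl) v hv
  · exact (h'.mono Finset.subset_union_right le_rfl) v hv

/-- The minimum cardinality of a set that covers `W`. -/
noncomputable def coverNumber (G : SimpleGraph V) (k : ℕ) (W : Finset V) : ℕ :=
  sInf {m | ∃ D : Finset V, G.Covers k D W ∧ D.card = m}

theorem coverNumber_le {D W : Finset V} (h : G.Covers k D W) : G.coverNumber k W ≤ D.card :=
  Nat.sInf_le ⟨D, h, rfl⟩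

/-- Some cover has to be given: without one, `coverNumber` is `sInf ∅ = 0`. -/
theorem Covers.exists_card_eq {D W : Finset V} (h : G.Covers k D W) :
    ∃ D', G.Covers k D' W ∧ D'.card = G.coverNumber k W :=
  Nat.sInf_mem (s := {m | ∃ D : Finset V, G.Covers k D W ∧ D.card = m}) ⟨_, D, h, rfl⟩

open Classical in
theorem Covers.le_coverNumber {D W : Finset V} (h : G.Covers k D W) {v : V} (hv : v ∈ W) :
    k ≤ G.coverNumber k W := by
  obtain ⟨D', h', hc⟩ := h.exists_card_eq
  exact hc ▸ (h' v hv).trans (Finset.card_filter_le _ _)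

/-- The closed neighbourhoods of `u` and `v` meet. -/
def Near (G : SimpleGraph V) (u v : V) : Prop :=
  ∃ x, (x = u ∨ G.Adj u x) ∧ (x = v ∨ G.Adj v x)

theorem Near.symm {u v : V} (h : G.Near u v) : G.Near v u := by
  obtain ⟨x, h1, h2⟩ := h
  exact ⟨x, h2, h1⟩

theorem Near.refl (u : V) : G.Near u u := ⟨u, .inl rfl, .inl rfl⟩

/-- An optimal cover of the union, restricted to the closed neighbourhoods of either part, still
covers that part. As no vertex of one part is near the other, the two restrictions are disjoint. -/
theorem Covers.coverNumber_add_le [DecidableEq V] {D W W' : Finset V}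
    (h : G.Covers k D (W ∪ W')) (hf : ∀ u ∈ W, ∀ v ∈ W', ¬ G.Near u v) :
    G.coverNumber k W + G.coverNumber k W' ≤ G.coverNumber k (W ∪ W') := by
  classical
  obtain ⟨E, hE, hc⟩ := h.exists_card_eq
  let nb (X : Finset V) := E.filter fun x => ∃ u ∈ X, x = u ∨ G.Adj u x
  have cov (X : Finset V) (hX : X ⊆ W ∪ W') : G.Covers k (nb X) X := by
    intro v hv
    refine (hE v (hX hv)).trans (Finset.card_le_card fun x hx => ?_)
    simp only [nb, Finset.mem_filter] at hx ⊢
    exact ⟨⟨hx.1, v, hv, hx.2⟩, hx.2⟩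
  have hd : Disjoint (nb W) (nb W') := by
    rw [Finset.disjoint_left]
    intro x hx hx'
    obtain ⟨-, u, hu, h1⟩ := Finset.mem_filter.1 hx
    obtain ⟨-, v, hv, h2⟩ := Finset.mem_filter.1 hx'
    exact hf u hu v hv ⟨x, h1, h2⟩
  calc _ ≤ (nb W).card + (nb W').card :=
        add_le_add (coverNumber_le (cov W Finset.subset_union_left))
          (coverNumber_le (cov W' Finset.subset_union_right))
    _ = (nb W ∪ nb W').card := (Finset.card_union_of_disjoint hd).symm
    _ ≤ E.card := Finset.card_le_card
        (Finset.union_subset (Finset.filter_subset _ _) (Finset.filter_subset _ _))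
    _ = _ := hc

/-- A clique is covered by few vertices. -/
theorem Covers.exists_card_le_sq {D Q : Finset V} (h : G.Covers k D Q)
    (hQ : ∀ u ∈ Q, ∀ v ∈ Q, v = u ∨ G.Adj u v) : ∃ E, G.Covers k E Q ∧ E.card ≤ k ^ 2 := by
  classical
  -- In a large clique any `k` members serve all of it. A clique with fewer than `k` members can
  -- afford `k` separate neighbours for each, taken from `D`.
  by_cases hk : k ≤ Q.card
  · obtain ⟨E, hEQ, hE⟩ := Finset.exists_subset_card_eq hk
    refine ⟨E, fun v hv => ?_, hE ▸ Nat.le_self_pow two_ne_zero k⟩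
    rw [Finset.filter_true_of_mem fun x hx => hQ v hv x (hEQ hx), hE]
  · have (v : V) : ∃ E : Finset V, E.card ≤ k ∧
        (v ∈ Q → k ≤ (E.filter fun u => u = v ∨ G.Adj v u).card) := by
      by_cases hv : v ∈ Q
      · obtain ⟨E, hE, hc⟩ := Finset.exists_subset_card_eq (h v hv)
        refine ⟨E, hc.le, fun _ => ?_⟩
        rw [Finset.filter_true_of_mem fun x hx => (Finset.mem_filter.1 (hE hx)).2, hc]
      · exact ⟨∅, by simp, fun h => absurd h hv⟩
    choose E hE hc using this
    refine ⟨Q.biUnion E, fun v hv => (hc v hv).trans (Finset.card_le_card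
      (Finset.filter_subset_filter _ (Finset.subset_biUnion_of_mem E hv))), ?_⟩
    calc _ ≤ Q.card * k := Finset.card_biUnion_le_card_mul _ _ _ fun v _ => hE v
      _ ≤ k ^ 2 := by rw [sq]; exact Nat.mul_le_mul_right k (by omega)

theorem Covers.coverNumber_le_of_cells {ι : Type*} {D W : Finset V} (h : G.Covers k D W)
    (cell : V → ι) (I : Finset ι) (hI : ∀ v ∈ W, cell v ∈ I)
    (hc : ∀ u ∈ W, ∀ v ∈ W, cell u = cell v → v = u ∨ G.Adj u v) :
    G.coverNumber k W ≤ I.card * k ^ 2 := by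
  classical
  have (i : ι) : ∃ E, G.Covers k E (W.filter fun v => cell v = i) ∧ E.card ≤ k ^ 2 := by
    refine (h.mono le_rfl (Finset.filter_subset _ _)).exists_card_le_sq fun u hu v hv => ?_
    rw [Finset.mem_filter] at hu hv
    exact hc u hu.1 v hv.1 (hu.2.trans hv.2.symm)
  choose E hE hcard using this
  have : G.Covers k (I.biUnion E) W := fun v hv =>
    (hE (cell v) v (by simp [hv])).trans (Finset.card_le_card
      (Finset.filter_subset_filter _ (Finset.subset_biUnion_of_mem E (hI v hv))))
  exact (coverNumber_le this).trans (Finset.card_biUnion_le_card_mul _ _ _ fun i _ => hcard i)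

/-- Cells are squares of side 1/2: two points in one cell differ by less than 1/2 in each
coordinate, so their vertices are equal or adjacent. Relative to `p` the cell indices run from `-2r`
to `2r` in each coordinate. -/
theorem Covers.coverNumber_le_of_dist {D W : Finset V} (h : G.Covers k D W)
    {c : V → EuclideanSpace ℝ (Fin 2)}
    (hc : ∀ u v, G.Adj u v ↔ u ≠ v ∧ c u ∈ Metric.closedBall (c v) 1) (p : EuclideanSpace ℝ (Fin 2))
    (r : ℕ) (hr : ∀ v ∈ W, Dist.dist (c v) p ≤ r) :
    G.coverNumber k W ≤ (4 * r + 1) ^ 2 * k ^ 2 := by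
  let cell (v : V) : ℤ × ℤ := (⌊2 * (c v 0 - p 0)⌋, ⌊2 * (c v 1 - p 1)⌋)
  have hI : (Finset.Icc (-(2 * r : ℤ)) (2 * r) ×ˢ Finset.Icc (-(2 * r : ℤ)) (2 * r)).card
      = (4 * r + 1) ^ 2 := by
    rw [Finset.card_product, Int.card_Icc, sq,
      show (2 * (r : ℤ) + 1 - -(2 * r)).toNat = 4 * r + 1 by omega]
  rw [← hI]
  refine h.coverNumber_le_of_cells cell _ (fun v hv => ?_) fun u hu v hv huv => ?_
  · have hd := hr v hv
    have hi (i : Fin 2) : ⌊2 * (c v i - p i)⌋ ∈ Finset.Icc (-(2 * r : ℤ)) (2 * r) := by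
      have h1 : |c v i - p i| ≤ r := by
        have := (PiLp.norm_apply_le (c v - p) i).trans (dist_eq_norm (c v) p ▸ hd)
        simpa using this
      rw [abs_le] at h1
      rw [Finset.mem_Icc, Int.le_floor]
      refine ⟨by push_cast; linarith, ?_⟩
      have : (⌊2 * (c v i - p i)⌋ : ℝ) ≤ 2 * r := (Int.floor_le _).trans (by linarith)
      exact_mod_cast this
    exact Finset.mem_product.2 ⟨hi 0, hi 1⟩
  · by_cases he : v = u
    · exact .inl he
    refine .inr ((hc u v).2 ⟨Ne.symm he, ?_⟩)
    rw [Metric.mem_closedBall, EuclideanSpace.dist_eq, Fin.sum_univ_two, Real.dist_eq,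
      Real.dist_eq, sq_abs, sq_abs]
    have h0 := abs_lt.1 (Int.abs_sub_lt_one_of_floor_eq_floor (congrArg Prod.fst huv))
    have h1 := abs_lt.1 (Int.abs_sub_lt_one_of_floor_eq_floor (congrArg Prod.snd huv))
    rw [Real.sqrt_le_one]
    nlinarith

theorem Near.dist_le {c : V → EuclideanSpace ℝ (Fin 2)}
    (hc : ∀ u v, G.Adj u v ↔ u ≠ v ∧ c u ∈ Metric.closedBall (c v) 1) {u v : V}
    (h : G.Near u v) : Dist.dist (c u) (c v) ≤ 2 := by
  have key (x y : V) (hxy : y = x ∨ G.Adj x y) : Dist.dist (c x) (c y) ≤ 1 := by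
    rcases hxy with rfl | hxy
    · simp
    · exact ((hc _ _).1 hxy).2
  obtain ⟨x, h1, h2⟩ := h
  have := dist_triangle_right (c u) (c v) (c x)
  linarith [key u x h1, key v x h2]

/-- An exponential function outgrows the quadratic bounds for cover numbers. -/
theorem exists_mul_pow_lt_pow (q k : ℕ) (hq : 0 < q) :
    ∃ J, (4 * (2 * J) + 1) ^ 2 * k ^ 2 * q ^ J < (q + 1) ^ J := by
  -- The constant is 81 = 9², because `4 * (2 * J) + 1 ≤ 9 * J` once `1 ≤ J`.
  have h := (tendsto_pow_const_div_const_pow_of_one_lt 2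
    (r := (q + 1 : ℝ) / q) (by rw [one_lt_div (by positivity)]; linarith)).const_mul
      (81 * (k : ℝ) ^ 2)
  rw [mul_zero] at h
  obtain ⟨J, h1, hJ⟩ := ((h.eventually (gt_mem_nhds one_pos)).and
    (Filter.eventually_ge_atTop 1)).exists
  refine ⟨J, ?_⟩
  have hq' : (0 : ℝ) < q := by exact_mod_cast hq
  have hJ' : (1 : ℝ) ≤ J := by exact_mod_cast hJ
  rw [div_pow, mul_div_assoc', div_lt_one (by positivity), lt_div_iff₀ (by positivity)] at h1
  have h2 : ((4 * (2 * J) + 1) ^ 2 * k ^ 2 * q ^ J : ℝ) ≤ 81 * k ^ 2 * J ^ 2 * q ^ J := by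
    refine mul_le_mul_of_nonneg_right ?_ (by positivity)
    rw [mul_right_comm]
    exact mul_le_mul_of_nonneg_right (by nlinarith) (by positivity)
  exact_mod_cast h2.trans_lt h1

end SimpleGraph

namespace RAM

/-! ### Vertex tuples as numerals -/

/-- The successor of a bijective numeral in base `n`, the least significant digit first. -/
def incDigits (n : ℕ) : List ℕ → List ℕ
  | [] => [1]
  | a :: l => if a = n then 1 :: incDigits n l else (a + 1) :: l

/-- The value of a bijective numeral in base `n`. -/
def digitsVal (n : ℕ) : List ℕ → ℕ
  | [] => 0
  | a :: l => a + n * digitsVal n l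

/-- The digits of bijective numerals in base `n` are `1, …, n`. -/
def ValidDigits (n : ℕ) (l : List ℕ) : Prop := ∀ a ∈ l, 1 ≤ a ∧ a ≤ n

theorem validDigits_cons {n a : ℕ} {l : List ℕ} :
    ValidDigits n (a :: l) ↔ (1 ≤ a ∧ a ≤ n) ∧ ValidDigits n l := by
  simp [ValidDigits]

theorem ValidDigits.inc {n : ℕ} (hn : 1 ≤ n) : ∀ {l : List ℕ}, ValidDigits n l →
    ValidDigits n (incDigits n l)
  | [], _ => by simp [incDigits, ValidDigits, hn]
  | a :: l, h => by
    rw [validDigits_cons] at h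
    rw [incDigits]
    split_ifs with ha
    · exact validDigits_cons.2 ⟨⟨le_rfl, hn⟩, h.2.inc hn⟩
    · exact validDigits_cons.2 ⟨⟨by omega, by omega⟩, h.2⟩

theorem digitsVal_inc (n : ℕ) : ∀ l : List ℕ, digitsVal n (incDigits n l) = digitsVal n l + 1
  | [] => by simp [incDigits, digitsVal]
  | a :: l => by
    rw [incDigits]
    split_ifs with ha
    · simp only [digitsVal, digitsVal_inc n l, ha]; ring
    · simp only [digitsVal]; ring

/-- Two digits differ by less than `n`, so the higher parts must agree. Without a digit 0 there is
no padding, and lengths agree as well. -/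
theorem ValidDigits.eq_of_val_eq {n : ℕ} : ∀ {l l' : List ℕ}, ValidDigits n l →
    ValidDigits n l' → digitsVal n l = digitsVal n l' → l = l'
  | [], [], _, _, _ => rfl
  | [], a :: l, _, h', h => by
    rw [validDigits_cons] at h'
    simp only [digitsVal] at h; omega
  | a :: l, [], h', _, h => by
    rw [validDigits_cons] at h'
    simp only [digitsVal] at h; omega
  | a :: l, b :: l', hl, hl', h => by
    rw [validDigits_cons] at hl hl'
    simp only [digitsVal] at h
    have hv : digitsVal n l = digitsVal n l' := by
      rcases lt_trichotomy (digitsVal n l) (digitsVal n l') with hlt | heq | hlt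
      · have := Nat.mul_le_mul_left n (Nat.succ_le_of_lt hlt)
        rw [Nat.mul_succ] at this; omega
      · exact heq
      · have := Nat.mul_le_mul_left n (Nat.succ_le_of_lt hlt)
        rw [Nat.mul_succ] at this; omega
    rw [hv] at h
    rw [hl.2.eq_of_val_eq hl'.2 hv, show a = b by omega]

/-- This is the point of bijective numerals: counting upwards meets all shorter tuples before any
longer one. -/
theorem ValidDigits.val_lt_of_length_lt {n : ℕ} : ∀ {l l' : List ℕ}, ValidDigits n l →
    ValidDigits n l' → l.length < l'.length → digitsVal n l < digitsVal n l'
  | _, [], _, _, h => by simp at h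
  | [], b :: l', _, hl', _ => by
    rw [validDigits_cons] at hl'
    simp only [digitsVal]; omega
  | a :: l, b :: l', hl, hl', h => by
    rw [validDigits_cons] at hl hl'
    have := Nat.mul_le_mul_left n (Nat.succ_le_of_lt (hl.2.val_lt_of_length_lt hl'.2
      (by simpa using h)))
    rw [Nat.mul_succ] at this
    simp only [digitsVal]; omega

theorem ValidDigits.val_lt_pow {n : ℕ} : ∀ {l : List ℕ}, ValidDigits n l →
    digitsVal n l < (n + 1) ^ l.length
  | [], _ => by simp [digitsVal]
  | a :: l, hl => by
    rw [validDigits_cons] at hl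
    have := Nat.mul_le_mul_left (n + 1) (Nat.succ_le_of_lt hl.2.val_lt_pow)
    rw [List.length_cons, pow_succ', digitsVal]
    nlinarith

/-- The digit `x + 1` stands for the vertex `x`. -/
def digitSet (n : ℕ) (l : List ℕ) : Finset (Fin n) :=
  Finset.univ.filter fun x => (x : ℕ) + 1 ∈ l

theorem mem_digitSet {n : ℕ} {l : List ℕ} {x : Fin n} : x ∈ digitSet n l ↔ (x : ℕ) + 1 ∈ l := by
  simp [digitSet]

theorem card_digitSet_le (n : ℕ) (l : List ℕ) : (digitSet n l).card ≤ l.length := by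
  classical
  refine (Finset.card_le_card_of_injOn (t := l.toFinset) (fun x : Fin n => (x : ℕ) + 1)
    (fun x hx => by simpa using mem_digitSet.1 hx)
    (fun x _ y _ h => Fin.ext (by simpa using h))).trans (List.toFinset_card_le l)

theorem exists_digitSet_eq {n : ℕ} (E : Finset (Fin n)) :
    ∃ l, ValidDigits n l ∧ l.length = E.card ∧ digitSet n l = E := by
  refine ⟨E.toList.map fun x : Fin n => (x : ℕ) + 1, ?_, by simp, ?_⟩
  · intro a ha
    obtain ⟨x, -, rfl⟩ := List.mem_map.1 ha
    exact ⟨by omega, x.2⟩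
  · ext x
    simp [mem_digitSet, Fin.val_inj]

/-- The program that replaces the numeral in array 5 by its successor. -/
def incr : Prog :=
  .seq (.assign 3 (.const 0)) (.seq
    (.loop (.sub (.const 1) (.sub (.reg 0) (.get 5 (.reg 3))))
      (.seq (.store 5 (.reg 3) (.const 1)) (.assign 3 (.add (.reg 3) (.const 1)))))
    (.store 5 (.reg 3) (.add (.get 5 (.reg 3)) (.const 1))))

/-- The guard `1 - (n - a)` is nonzero exactly when the digit is `n`, that is, when there is a
carry. The last clause describes the array as if the increment still pending at register 3 had been
made; past the last digit it turns the default 0 into a new digit 1. -/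
theorem Halts.incr_loop {n : ℕ} (hn : 1 ≤ n) : ∀ (l : List ℕ) (i : ℕ) (s : State),
    ValidDigits n l → s.reg 0 = n → s.reg 3 = i → (∀ j, s.arr 5 (i + j) = l.getD j 0) →
    Halts (.loop (.sub (.const 1) (.sub (.reg 0) (.get 5 (.reg 3))))
      (.seq (.store 5 (.reg 3) (.const 1)) (.assign 3 (.add (.reg 3) (.const 1))))) s
      (l.length * 14 + 7) (fun s' => (∀ x ≠ 3, s'.reg x = s.reg x) ∧
        (∀ b ≠ 5, s'.arr b = s.arr b) ∧ (∀ j < i, s'.arr 5 j = s.arr 5 j) ∧ i ≤ s'.reg 3 ∧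
        ∀ j, (if i + j = s'.reg 3 then s'.arr 5 (s'.reg 3) + 1 else s'.arr 5 (i + j)) =
          (incDigits n l).getD j 0) := by
  intro l
  induction l with
  | nil =>
    intro i s _ h0 h3 ha
    have hi : s.arr 5 i = 0 := by simpa using ha 0
    refine (Halts.loop_exit ?_ ?_).mono (by simp [Expr.cost]) (fun _ h => h)
    · simp only [Expr.eval, h0, h3, hi]; omega
    · refine ⟨fun _ _ => rfl, fun _ _ => rfl, fun _ _ => rfl, h3.ge, fun j => ?_⟩
      rw [h3, hi]
      rcases j with _ | j
      · simp [incDigits]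
      · rw [if_neg (by omega), ha]; simp [incDigits]
  | cons a l ih =>
    intro i s hl h0 h3 ha
    rw [validDigits_cons] at hl
    have hi : s.arr 5 i = a := by simpa using ha 0
    by_cases han : a = n
    · refine (Halts.loop_step (T := 7) (T' := l.length * 14 + 7) ?_ ?_).mono
        (by simp only [Expr.cost, List.length_cons]; omega) (fun _ h => h)
      · simp only [Expr.eval, h0, h3, hi]; omega
      · refine Halts.seq (T := 3) (T' := 4) (Halts.store (Halts.assign ?_))
        refine (ih (i + 1) _ hl.2 (by simpa [Expr.eval] using h0) (by simp [Expr.eval, h3])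
          fun j => ?_).mono le_rfl ?_
        · rw [State.setReg_arr, State.setArr_arr, if_neg (by simp only [Expr.eval]; omega),
            add_assoc, add_comm 1, ha]
          simp
        · rintro s' ⟨h1, h2, h4, h5, h6⟩
          refine ⟨fun x hx => ?_, fun b hb => ?_, fun j hj => ?_, by omega, fun j => ?_⟩
          · rw [h1 x hx, State.setReg_reg, if_neg hx]; rfl
          · rw [h2 b hb]; funext j; rw [State.setReg_arr, State.setArr_arr, if_neg (by tauto)]
          · rw [h4 j (by omega), State.setReg_arr, State.setArr_arr,
              if_neg (by simp only [Expr.eval]; omega)]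
          · rw [incDigits, if_pos han]
            rcases j with _ | j
            · rw [if_neg (by omega), h4 (i + 0) (by omega), State.setReg_arr, State.setArr_arr,
                if_pos (by simp [Expr.eval, h3])]
              simp [Expr.eval]
            · have := h6 j
              rw [add_right_comm] at this
              simpa [← add_assoc] using this
    · refine (Halts.loop_exit ?_ ?_).mono (by simp [Expr.cost]) (fun _ h => h)
      · simp only [Expr.eval, h0, h3, hi]; omega
      · refine ⟨fun _ _ => rfl, fun _ _ => rfl, fun _ _ => rfl, h3.ge, fun j => ?_⟩
        rw [h3, hi, incDigits, if_neg han]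
        rcases j with _ | j
        · simp
        · rw [if_neg (by omega), ha]; simp

theorem Halts.incr {n : ℕ} {l : List ℕ} {s : State} {Q : State → Prop} (hn : 1 ≤ n)
    (hl : ValidDigits n l) (h0 : s.reg 0 = n) (ha : ∀ j, s.arr 5 j = l.getD j 0)
    (h : ∀ s', (∀ x ≠ 3, s'.reg x = s.reg x) → (∀ b ≠ 5, s'.arr b = s.arr b) →
      (∀ j, s'.arr 5 j = (incDigits n l).getD j 0) → Q s') :
    Halts incr s (l.length * 14 + 15) Q := by
  refine (Halts.seq (T := 2) (T' := l.length * 14 + 13) (Halts.assign (Halts.seq (T' := 6)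
    ((Halts.incr_loop hn l 0 _ hl (by simpa [Expr.eval] using h0) (by simp [Expr.eval])
      (by simpa using ha)).mono le_rfl ?_)))).mono (by omega) (fun _ h => h)
  rintro s' ⟨h1, h2, -, -, h6⟩
  refine Halts.store (h _ (fun x hx => ?_) (fun b hb => ?_) fun j => ?_)
  · rw [State.setArr_reg, h1 x hx, State.setReg_reg, if_neg hx]
  · funext j
    rw [State.setArr_arr, if_neg (by tauto), h2 b hb]; rfl
  · rw [State.setArr_arr, ← h6 j]
    simp only [Expr.eval, true_and, zero_add]

end RAM

namespace RAM

/-! ### Formulas -/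

namespace BExpr

/-- The truth value of `e = 0`. -/
def notE (e : BExpr) : BExpr := .sub (.const 1) e

/-- The truth value of `e ≠ 0 ∧ f ≠ 0`. -/
def andE (e f : BExpr) : BExpr := .sub (.const 1) (.add (notE e) (notE f))

/-- The truth value of `e = f`. -/
def eqE (e f : BExpr) : BExpr := notE (.add (.sub e f) (.sub f e))

/-- Nonzero if the vertex `e` is in the closed neighbourhood of the vertex `f`; here `m` is the
number of variables in the scope. -/
def nbE (m : ℕ) (e f : BExpr) : BExpr :=
  .add (eqE f e) (.get 0 (.add (.sum m e) f))

/-- Nonzero if the vertex `e` occurs in the tuple held by array 5. -/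
def memE (m : ℕ) (e : BExpr) : BExpr := .sum m (eqE (.get 5 (.var m)) (.add e (.const 1)))

/-- Nonzero if some vertex has less than `k` elements in its closed neighbourhood. -/
def guardE : BExpr :=
  .sum 0 (.sub (.reg 1) (.sum 1 (notE (notE (nbE 2 (.var 0) (.var 1))))))

/-- Nonzero if the tuple held by array 5 does not cover the set held by array 3. -/
def badE : BExpr :=
  .sum 0 (andE (.get 3 (.var 0)) (.sub (.reg 1)
    (.sum 1 (andE (nbE 2 (.var 0) (.var 1)) (memE 2 (.var 1))))))

/-- The length of the tuple held by array 5. -/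
def lenE : BExpr := .sum 0 (notE (notE (.get 5 (.var 0))))

/-- The vertices that are not removed and near to a vertex of the set held by array 3. -/
def growE : BExpr :=
  andE (notE (.get 2 (.var 0))) (.sum 1 (.sum 2 (andE (.get 3 (.var 1))
    (andE (nbE 3 (.var 1) (.var 2)) (nbE 3 (.var 0) (.var 2))))))

/-- The single vertex in register 2. -/
def initE : BExpr := eqE (.var 0) (.reg 2)

/-- The output together with the tuple held by array 5. -/
def outE : BExpr := notE (notE (.add (.get 1 (.var 0)) (memE 1 (.var 0))))

/-- The removed vertices together with the set held by array 3. -/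
def remE : BExpr := notE (notE (.add (.get 2 (.var 0)) (.get 3 (.var 0))))

variable {s : State} {env : ℕ → ℕ} {e f : BExpr} {n : ℕ}

@[simp] theorem eval_const (c : ℕ) : (const c).eval s env = c := rfl

@[simp] theorem eval_reg (x : ℕ) : (reg x).eval s env = s.reg x := rfl

@[simp] theorem eval_var (i : ℕ) : (var i).eval s env = env i := rfl

@[simp] theorem eval_get (a : ℕ) : (get a e).eval s env = s.arr a (e.eval s env) := rfl

@[simp] theorem eval_add : (add e f).eval s env = e.eval s env + f.eval s env := rfl

@[simp] theorem eval_sub : (sub e f).eval s env = e.eval s env - f.eval s env := rfl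

@[simp] theorem eval_notE : (notE e).eval s env = if e.eval s env = 0 then 1 else 0 := by
  simp only [notE, eval]; split_ifs <;> omega

@[simp] theorem eval_andE :
    (andE e f).eval s env = if e.eval s env ≠ 0 ∧ f.eval s env ≠ 0 then 1 else 0 := by
  simp only [andE, eval, eval_notE]; split_ifs <;> omega

@[simp] theorem eval_eqE :
    (eqE e f).eval s env = if e.eval s env = f.eval s env then 1 else 0 := by
  rw [eqE, eval_notE, eval_add, eval_sub, eval_sub]
  exact if_congr (by omega) rfl rfl

theorem eval_sum (h : s.reg 0 = n) (i : ℕ) :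
    (sum i e).eval s env = ∑ x : Fin n, e.eval s (Function.update env i x) := by
  rw [eval, h, Finset.sum_range]

theorem eval_sum_eq_zero (h : s.reg 0 = n) (i : ℕ) :
    (sum i e).eval s env = 0 ↔ ∀ x : Fin n, e.eval s (Function.update env i x) = 0 := by
  rw [eval_sum h]; simp

end BExpr

/-! ### Machine states representing sets, and the meaning of the formulas -/

open Classical in
/-- The state `s` represents the input `(G, k)`, the current vertex `v`, the output `O`, the set `R`
of removed vertices, the current set `W`, the tuple `l`, and the sizes `m` and `m'` of minimum
covers of the previous and the current set. -/
structure Rep {n : ℕ} (G : SimpleGraph (Fin n)) (k v : ℕ) (O R W : Finset (Fin n)) (l : List ℕ)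
    (m m' : ℕ) (s : State) : Prop where
  reg_zero : s.reg 0 = n
  reg_one : s.reg 1 = k
  reg_two : s.reg 2 = v
  reg_four : s.reg 4 = m
  reg_five : s.reg 5 = m'
  adj : ∀ x y : Fin n, s.arr 0 (n * x + y) = if G.Adj x y then 1 else 0
  out : ∀ x : Fin n, s.arr 1 x = if x ∈ O then 1 else 0
  rem : ∀ x : Fin n, s.arr 2 x = if x ∈ R then 1 else 0
  cur : ∀ x : Fin n, s.arr 3 x = if x ∈ W then 1 else 0
  dig : ∀ i, s.arr 5 i = l.getD i 0
  valid : ValidDigits n l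
  length_le : l.length ≤ n

section

variable {n : ℕ} {G : SimpleGraph (Fin n)} {k v m m' : ℕ} {O R W : Finset (Fin n)} {l : List ℕ}
  {s : State}

open BExpr

/-- The machine cannot multiply: the row offset `n * x` is a sum of `n` copies of `e`. Hence `e` is
required to ignore the bound variable `i`. -/
theorem Rep.eval_nbE (h : Rep G k v O R W l m m' s) {e f : BExpr} {env : ℕ → ℕ} {i : ℕ}
    {x y : Fin n} (he : ∀ j, e.eval s (Function.update env i j) = x) (hf : f.eval s env = y)
    (he' : e.eval s env = x) :
    (nbE i e f).eval s env ≠ 0 ↔ y = x ∨ G.Adj x y := by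
  have := h.adj x y
  simp only [nbE, eval, eval_eqE, he, hf, he', h.reg_zero, Finset.sum_const, Finset.card_range,
    smul_eq_mul, this, Fin.val_inj]
  split_ifs <;> simp_all

/-- The sum inspects only the first `n` entries of array 5, which suffices by `length_le`. Entries
past the tuple are 0 and match no vertex. -/
theorem Rep.eval_memE (h : Rep G k v O R W l m m' s) {e : BExpr} {env : ℕ → ℕ} {i : ℕ}
    {x : Fin n} (he : ∀ j, e.eval s (Function.update env i j) = x) :
    (memE i e).eval s env ≠ 0 ↔ x ∈ digitSet n l := by
  rw [memE, Ne, eval_sum_eq_zero h.reg_zero, mem_digitSet, List.mem_iff_getElem]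
  simp only [eval_eqE, eval, he, Function.update_self, h.dig]
  push Not
  constructor
  · rintro ⟨j, hj⟩
    have hj' : l.getD j 0 = x + 1 := by by_contra hne; exact hj (if_neg hne)
    have hlt : (j : ℕ) < l.length := by
      by_contra hge
      rw [List.getD_eq_default _ _ (by omega)] at hj'; omega
    exact ⟨j, hlt, by rwa [List.getD_eq_getElem _ _ hlt] at hj'⟩
  · rintro ⟨j, hlt, hj⟩
    refine ⟨⟨j, hlt.trans_le h.length_le⟩, ?_⟩
    rw [if_pos]
    · simp
    · simp [hlt, hj]

open Classical in
theorem Rep.eval_guardE (h : Rep G k v O R W l m m' s) :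
    guardE.eval s 0 = 0 ↔ G.Covers k Finset.univ Finset.univ := by
  rw [guardE, eval_sum_eq_zero h.reg_zero]
  simp only [SimpleGraph.Covers, Finset.mem_univ, true_imp_iff]
  refine forall_congr' fun u => ?_
  rw [eval_sub, eval_reg, eval_sum h.reg_zero, h.reg_one, Nat.sub_eq_zero_iff_le, Finset.card_filter]
  refine iff_of_eq (congrArg (k ≤ ·) (Finset.sum_congr rfl fun x _ => ?_))
  have := h.eval_nbE (e := .var 0) (f := .var 1) (i := 2) (x := u) (y := x)
    (env := Function.update (Function.update 0 0 u) 1 x) (by simp) (by simp)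
    (by simp)
  simp only [eval_notE, ← this]
  split_ifs <;> simp_all

open Classical in
theorem Rep.eval_badE (h : Rep G k v O R W l m m' s) :
    badE.eval s 0 = 0 ↔ G.Covers k (digitSet n l) W := by
  rw [badE, eval_sum_eq_zero h.reg_zero]
  refine forall_congr' fun u => ?_
  have hc : eval s (Function.update 0 0 (u : ℕ))
      (.sum 1 (andE (nbE 2 (.var 0) (.var 1)) (memE 2 (.var 1)))) =
      ((digitSet n l).filter fun x => x = u ∨ G.Adj u x).card := by
    rw [eval_sum h.reg_zero, Finset.card_filter, ← Finset.sum_filter,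
      ← Finset.filter_univ_mem (digitSet n l), Finset.filter_filter, Finset.sum_filter]
    refine Finset.sum_congr rfl fun x _ => ?_
    rw [eval_andE]
    exact if_congr ((and_congr (h.eval_nbE (by simp) (by simp) (by simp))
      (h.eval_memE (by simp))).trans and_comm) rfl rfl
  rw [eval_andE]
  rw [eval_sub, hc, eval_reg, h.reg_one, eval_get, eval_var, Function.update_self, h.cur]
  by_cases hu : u ∈ W
  · simp only [hu, if_true, ite_eq_right_iff, true_imp_iff]
    simp only [ne_eq, one_ne_zero, not_false_eq_true, true_and, imp_false, not_not]
    rw [Nat.sub_eq_zero_iff_le]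
    exact iff_of_eq (by congr!)
  · simp [hu]

theorem Rep.eval_lenE (h : Rep G k v O R W l m m' s) : lenE.eval s 0 = l.length := by
  rw [lenE, eval, h.reg_zero]
  simp only [eval_notE, eval_get, eval_var, Function.update_self, h.dig]
  have : ∀ i, (if (if l.getD i 0 = 0 then 1 else 0) = 0 then 1 else 0) =
      if i < l.length then 1 else 0 := by
    intro i
    by_cases hi : i < l.length
    · have := (h.valid _ (List.getElem_mem hi)).1
      rw [List.getD_eq_getElem _ _ hi, if_pos hi, if_neg (c := l[i] = 0) (by omega),
        if_pos rfl]
    · rw [List.getD_eq_default _ _ (by omega)]; simp [hi]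
  simp only [this]
  rw [← Finset.card_filter, ← Finset.card_range l.length]
  congr 1
  ext i
  simp only [Finset.mem_filter, Finset.mem_range, Finset.card_range]
  have := h.length_le
  omega

open Classical in
/-- The vertices outside `R` that are near to a vertex of `W`. -/
noncomputable def growSet (G : SimpleGraph (Fin n)) (R W : Finset (Fin n)) : Finset (Fin n) :=
  Finset.univ.filter fun x => x ∉ R ∧ ∃ w ∈ W, G.Near w x

open Classical in
theorem Rep.eval_growE (h : Rep G k v O R W l m m' s) (x : Fin n) :
    growE.eval s (fun _ => x) = if x ∈ growSet G R W then 1 else 0 := by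
  rw [growE, eval_andE]
  refine if_congr ?_ rfl rfl
  rw [Ne, Ne, eval_sum_eq_zero h.reg_zero, growSet, Finset.mem_filter]
  simp only [eval_sum_eq_zero h.reg_zero, eval_notE, eval_andE]
  simp only [Finset.mem_univ, true_and]
  refine and_congr ?_ ?_
  · simp only [eval_get, eval_var, h.rem]; split_ifs <;> simp_all
  · push Not
    refine exists_congr fun w => ?_
    have (y : Fin n) := h.eval_nbE (e := .var 1) (f := .var 2) (i := 3) (x := w) (y := y)
      (env := Function.update (Function.update (fun _ => (x : ℕ)) 1 w) 2 y)
      (by simp) (by simp) (by simp)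
    have h' (y : Fin n) := h.eval_nbE (e := .var 0) (f := .var 2) (i := 3) (x := x) (y := y)
      (env := Function.update (Function.update (fun _ => (x : ℕ)) 1 w) 2 y)
      (by simp) (by simp) (by simp)
    have hw (y : ℕ) : eval s (Function.update (Function.update (fun _ => (x : ℕ)) 1 w) 2 y)
        (.get 3 (.var 1)) = if w ∈ W then 1 else 0 := by simp [h.cur]
    simp only [hw, SimpleGraph.Near, ← this, ← h']
    by_cases hwW : w ∈ W <;> simp [hwW]

open Classical in
theorem Rep.eval_initE (h : Rep G k v O R W l m m' s) (hv : v < n) (x : Fin n) :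
    initE.eval s (fun _ => x) = if x ∈ ({⟨v, hv⟩} : Finset (Fin n)) then 1 else 0 := by
  rw [initE, eval_eqE]
  simp [h.reg_two, Fin.ext_iff]

open Classical in
theorem Rep.eval_outE (h : Rep G k v O R W l m m' s) (x : Fin n) :
    outE.eval s (fun _ => x) = if x ∈ O ∪ digitSet n l then 1 else 0 := by
  have := h.eval_memE (e := .var 0) (env := fun _ => x) (i := 1) (x := x) (by simp)
  simp only [outE, eval_notE, eval_add, eval_get, eval_var, h.out, Finset.mem_union, ← this]
  by_cases hx : x ∈ O <;> simp [hx]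

open Classical in
theorem Rep.eval_remE (h : Rep G k v O R W l m m' s) (x : Fin n) :
    remE.eval s (fun _ => x) = if x ∈ R ∪ W then 1 else 0 := by
  simp only [remE, eval_notE, eval_add, eval_get, eval_var, h.rem, h.cur, Finset.mem_union]
  by_cases hx : x ∈ R <;> by_cases hx' : x ∈ W <;> simp [hx, hx']

end
end RAM

namespace RAM

open BExpr

/-! ### The programs -/

/-- Find a shortest tuple that covers the current set, and put its length into register 5. -/
def search : Prog :=
  .seq (fillVia 5 (.const 0)) (.seq (assignB 6 badE) (.seq
    (.loop (.reg 6) (.seq incr (assignB 6 badE))) (assignB 5 lenE)))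

/-- Grow the current set and cover it. -/
def grow : Prog :=
  .seq (fillVia 3 growE) (.seq (.assign 4 (.reg 5)) search)

/-- The `c`-fold of an expression. -/
def mulExpr (e : Expr) : ℕ → Expr
  | 0 => .const 0
  | c + 1 => .add (mulExpr e c) e

theorem eval_mulExpr (s : State) (e : Expr) (c : ℕ) :
    (mulExpr e c).eval s = c * e.eval s := by
  induction c with
  | zero => simp [mulExpr, Expr.eval]
  | succ c ih => rw [mulExpr, Expr.eval, ih, Nat.succ_mul]

/-- Nonzero if the last growth step has increased the size of a minimum cover by more than the
factor `(q + 1) / q`. -/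
def growTest (q : ℕ) : Expr := .sub (mulExpr (.reg 5) q) (mulExpr (.reg 4) (q + 1))

/-- Cover the surroundings of the vertex in register 2. -/
def processVertex (q : ℕ) : Prog :=
  .seq (fillVia 3 initE) (.seq search (.seq grow (.seq (.loop (growTest q) grow)
    (.seq (fillVia 1 outE) (fillVia 2 remE)))))

/-- The whole program. -/
def tupleDomination (q : ℕ) : Prog :=
  .seq (assignB 6 guardE) (.cond (.reg 6) .skip
    (forLoop 2 (.cond (.get 2 (.reg 2)) .skip (processVertex q))))

/-! ### Correctness and running time of the search and of a growth step -/

section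

variable {n : ℕ} {G : SimpleGraph (Fin n)} {k v m m' : ℕ} {O R W : Finset (Fin n)} {l : List ℕ}
  {s s' : State}

theorem Rep.of_eq {m₁ m₁' v₁ : ℕ} (h : Rep G k v O R W l m m' s) (harr : s'.arr = s.arr)
    (h0 : s'.reg 0 = s.reg 0) (h1 : s'.reg 1 = s.reg 1) (h2 : s'.reg 2 = v₁)
    (h4 : s'.reg 4 = m₁) (h5 : s'.reg 5 = m₁') : Rep G k v₁ O R W l m₁ m₁' s' := by
  refine ⟨h0.trans h.reg_zero, h1.trans h.reg_one, h2, h4, h5, ?_, ?_, ?_, ?_, ?_, h.valid,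
    h.length_le⟩ <;> rw [harr]
  exacts [h.adj, h.out, h.rem, h.cur, h.dig]

theorem Rep.of_same (h : Rep G k v O R W l m m' s) (hs : Same s s') :
    Rep G k v O R W l m m' s' :=
  h.of_eq hs.1 (hs.2 _ (by omega)) (hs.2 _ (by omega)) ((hs.2 _ (by omega)).trans h.reg_two)
    ((hs.2 _ (by omega)).trans h.reg_four) ((hs.2 _ (by omega)).trans h.reg_five)

theorem Rep.setReg_six (h : Rep G k v O R W l m m' s) (c : ℕ) :
    Rep G k v O R W l m m' (s.setReg 6 c) :=
  h.of_eq rfl (by simp) (by simp) (by simpa using h.reg_two) (by simpa using h.reg_four)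
    (by simpa using h.reg_five)

theorem Rep.setReg_five (h : Rep G k v O R W l m m' s) (c : ℕ) :
    Rep G k v O R W l m c (s.setReg 5 c) :=
  h.of_eq rfl (by simp) (by simp) (by simpa using h.reg_two) (by simpa using h.reg_four)
    (by simp)

theorem Rep.setReg_four (h : Rep G k v O R W l m m' s) (c : ℕ) :
    Rep G k v O R W l c m' (s.setReg 4 c) :=
  h.of_eq rfl (by simp) (by simp) (by simpa using h.reg_two) (by simp)
    (by simpa using h.reg_five)

theorem Rep.setReg_two (h : Rep G k v O R W l m m' s) (c : ℕ) :
    Rep G k c O R W l m m' (s.setReg 2 c) :=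
  h.of_eq rfl (by simp) (by simp) (by simp) (by simpa using h.reg_four)
    (by simpa using h.reg_five)

/-- The array `a` is overwritten. -/
theorem Rep.of_fill {O' R' W' : Finset (Fin n)} {l' : List ℕ} (h : Rep G k v O R W l m m' s)
    (hreg : ∀ x < 16, s'.reg x = s.reg x) (a : ℕ) (ha : a ≠ 0)
    (harr : ∀ b ≠ a, b ≠ 4 → s'.arr b = s.arr b) (hO : a ≠ 1 → O' = O) (hR : a ≠ 2 → R' = R)
    (hW : a ≠ 3 → W' = W) (hl : a ≠ 5 → l' = l)
    (hO' : a = 1 → ∀ x : Fin n, s'.arr 1 x = if x ∈ O' then 1 else 0)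
    (hR' : a = 2 → ∀ x : Fin n, s'.arr 2 x = if x ∈ R' then 1 else 0)
    (hW' : a = 3 → ∀ x : Fin n, s'.arr 3 x = if x ∈ W' then 1 else 0)
    (hl' : a = 5 → (∀ i, s'.arr 5 i = l'.getD i 0) ∧ ValidDigits n l' ∧ l'.length ≤ n) :
    Rep G k v O' R' W' l' m m' s' := by
  have hdig : (∀ i, s'.arr 5 i = l'.getD i 0) ∧ ValidDigits n l' ∧ l'.length ≤ n := by
    by_cases h5 : a = 5
    · exact hl' h5
    · rw [hl h5, harr 5 (Ne.symm h5) (by omega)]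
      exact ⟨h.dig, h.valid, h.length_le⟩
  refine ⟨(hreg 0 (by omega)).trans h.reg_zero, (hreg 1 (by omega)).trans h.reg_one,
    (hreg 2 (by omega)).trans h.reg_two, (hreg 4 (by omega)).trans h.reg_four,
    (hreg 5 (by omega)).trans h.reg_five, ?_, ?_, ?_, ?_, hdig.1, hdig.2.1, hdig.2.2⟩
  · rw [harr 0 ha.symm (by omega)]; exact h.adj
  · intro x
    by_cases h5 : a = 1
    · convert hO' h5 x
    · rw [hO h5, harr 1 (Ne.symm h5) (by omega)]; exact h.out x
  · intro x
    by_cases h5 : a = 2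
    · convert hR' h5 x
    · rw [hR h5, harr 2 (Ne.symm h5) (by omega)]; exact h.rem x
  · intro x
    by_cases h5 : a = 3
    · convert hW' h5 x
    · rw [hW h5, harr 3 (Ne.symm h5) (by omega)]; exact h.cur x

theorem Rep.halts_fillVia_dig {Q : State → Prop} (h : Rep G k v O R W l m m' s)
    (hQ : ∀ s', Rep G k v O R W [] m m' s' → Q s') :
    Halts (fillVia 5 (.const 0)) s (n * 29 + 12) Q := by
  have := Halts.fillVia (a := 5) (e := .const 0) (s := s) (Q := Q) trivial trivial (by omega) ?_
  · rw [h.reg_zero] at this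
    exact this.mono (by simp [BExpr.time]) (fun _ h => h)
  · intro s' h1 h2 h3
    refine hQ s' (h.of_fill h1 5 (by omega) h2 (fun _ => rfl) (fun _ => rfl) (fun _ => rfl)
      (by omega) (by omega) (by omega) (by omega) ?_)
    · refine fun _ => ⟨fun i => ?_, by simp [ValidDigits], by simp⟩
      rw [h3, h.reg_zero, h.dig]
      split_ifs with hi
      · simp
      · rw [List.getD_eq_default _ _ (by have := h.length_le; omega)]; simp

/-- A bound for the running time of `search` if the minimum covers have at most `M` elements. -/
def searchTime (n M : ℕ) : ℕ :=
  n * 29 + 12 + (badE.time n + 2 + ((n + 1) ^ M * (2 + (n * 14 + 15 + (badE.time n + 2))) + 2 +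
    (lenE.time n + 2)))

theorem Rep.halts_assignB_six {Q : State → Prop} {e : BExpr} (h : Rep G k v O R W l m m' s)
    (hw : e.WF 0) (hQ : ∀ s', Rep G k v O R W l m m' s' → s'.reg 6 = e.eval s 0 → Q s') :
    Halts (assignB 6 e) s (e.time n + 2) Q := by
  have := Halts.assignB (x := 6) (e := e) (s := s) (Q := Q) hw fun s' hs =>
    hQ _ ((h.of_same hs).setReg_six _) (by simp)
  rwa [h.reg_zero] at this

/-- The tuples are tried in order of value, starting from the empty one. The value of `lE`, a
listing of a minimum cover, bounds the number of rounds and is below `(n + 1) ^ M`. -/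
theorem Rep.halts_search {M : ℕ} (h : Rep G k v O R W l m m' s) (hn : 1 ≤ n)
    (hG : G.Covers k Finset.univ W) (hM : G.coverNumber k W ≤ M) :
    Halts search s (searchTime n M) fun s' => ∃ l', Rep G k v O R W l' m (G.coverNumber k W) s' ∧
      G.Covers k (digitSet n l') W ∧ (digitSet n l').card ≤ G.coverNumber k W := by
  obtain ⟨E, hE, hEc⟩ := hG.exists_card_eq
  obtain ⟨lE, hlE, hlen, hset⟩ := exists_digitSet_eq E
  -- No covering tuple has been passed over. Compared with `lE`, this keeps the current tuple no
  -- longer than the cover number.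
  let Min (l : List ℕ) : Prop := ∀ d, ValidDigits n d → G.Covers k (digitSet n d) W →
    digitsVal n l ≤ digitsVal n d
  have hMinE {l : List ℕ} (hl : Min l) : digitsVal n l ≤ digitsVal n lE := hl lE hlE (hset ▸ hE)
  have hMinlen {l : List ℕ} (hv : ValidDigits n l) (hl : Min l) :
      l.length ≤ G.coverNumber k W := by
    rw [← hEc, ← hlen]
    by_contra! hlt
    exact absurd (hMinE hl) (not_le.2 (hlE.val_lt_of_length_lt hv hlt))
  -- With this the tuples never outgrow the `n` entries that the formulas read.
  have hγ : G.coverNumber k W ≤ n := by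
    rw [← hEc]; simpa using E.card_le_univ
  have hbad : badE.WF 0 := by simp [badE, WF, andE, notE, nbE, eqE, memE]
  refine Halts.seq (h.halts_fillVia_dig fun s1 r1 => ?_)
  refine Halts.seq (r1.halts_assignB_six hbad fun s2 r2 h2 => ?_)
  refine Halts.seq ?_
  have key := Halts.loop (p := .seq incr (assignB 6 badE)) (e := .reg 6)
    (T := n * 14 + 15 + (badE.time n + 2))
    (I := fun i s => ∃ l, Rep G k v O R W l m m' s ∧ Min l ∧
      digitsVal n l + i = digitsVal n lE ∧ (s.reg 6 = 0 ↔ G.Covers k (digitSet n l) W))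
    ?_ ?_ (digitsVal n lE) s2 ⟨[], r2, fun d _ _ => by simp [digitsVal], by simp [digitsVal],
      h2 ▸ r1.eval_badE⟩
  · refine key.mono ?_ ?_
    · have := hlE.val_lt_pow
      rw [hlen, hEc] at this
      have := this.le.trans (Nat.pow_le_pow_right (by omega) hM)
      exact Nat.add_le_add_right (Nat.mul_le_mul_right _ this) _
    · rintro s3 ⟨⟨-, -, l, r3, hmin, -, hc⟩, h6⟩
      have hcov := hc.1 h6
      -- Tuples may repeat vertices, but a covering one has at least as many entries as a minimum
      -- cover has elements, so here the length is exact.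
      have hlen' : l.length = G.coverNumber k W := le_antisymm (hMinlen r3.valid hmin)
        ((SimpleGraph.coverNumber_le hcov).trans (card_digitSet_le n l))
      have := Halts.assignB (x := 5) (e := lenE) (s := s3)
        (Q := fun s' => ∃ l', Rep G k v O R W l' m (G.coverNumber k W) s' ∧
          G.Covers k (digitSet n l') W ∧ (digitSet n l').card ≤ G.coverNumber k W)
        (by simp [lenE, WF, notE]) fun s4 hs => ?_
      · rwa [r3.reg_zero] at this
      · rw [r3.eval_lenE, hlen']
        exact ⟨l, (r3.of_same hs).setReg_five _, hcov, hlen' ▸ card_digitSet_le n l⟩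
  · rintro s3 ⟨l, r3, -, hval, hc⟩
    rw [r3.valid.eq_of_val_eq hlE hval, hset] at hc
    exact hc.2 hE
  · rintro i s3 ⟨l, r3, hmin, hval, hc⟩ h6
    have hncov : ¬ G.Covers k (digitSet n l) W := fun h => h6 (hc.2 h)
    have hmin' : Min (incDigits n l) := by
      intro d hd hcov
      rw [digitsVal_inc]
      refine Nat.succ_le_of_lt ((hmin d hd hcov).lt_of_ne fun he => ?_)
      exact hncov ((r3.valid.eq_of_val_eq hd he) ▸ hcov)
    have hv' := r3.valid.inc hn
    have hlen' := (hMinlen hv' hmin').trans hγ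
    refine Halts.seq ((Halts.incr (Q := fun s' => Rep G k v O R W (incDigits n l) m m' s') hn
      r3.valid r3.reg_zero r3.dig fun s4 h4 h4' h4'' => ?_).mono
      (by have := r3.length_le; omega) fun s4 r4 => ?_)
    · refine ⟨(h4 _ (by omega)).trans r3.reg_zero, (h4 _ (by omega)).trans r3.reg_one,
        (h4 _ (by omega)).trans r3.reg_two, (h4 _ (by omega)).trans r3.reg_four,
        (h4 _ (by omega)).trans r3.reg_five, ?_, ?_, ?_, ?_, h4'', hv', hlen'⟩
      · rw [h4' _ (by omega)]; exact r3.adj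
      · rw [h4' _ (by omega)]; exact r3.out
      · rw [h4' _ (by omega)]; exact r3.rem
      · rw [h4' _ (by omega)]; exact r3.cur
    · refine r4.halts_assignB_six hbad fun s5 r5 h5 =>
        ⟨_, r5, hmin', by rw [digitsVal_inc]; omega, h5 ▸ r4.eval_badE⟩

theorem Rep.halts_fillVia {Q : State → Prop} (h : Rep G k v O R W l m m' s) (a : ℕ) {e : BExpr}
    (hw : e.WF 1) (ha : e.Avoids 4) (ha4 : a ≠ 4)
    (hQ : ∀ s', (∀ x < 16, s'.reg x = s.reg x) → (∀ b ≠ a, b ≠ 4 → s'.arr b = s.arr b) →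
      (∀ x : Fin n, s'.arr a x = e.eval s fun _ => x) → Q s') :
    Halts (fillVia a e) s (n * (e.time n + 27) + 12) Q := by
  have := Halts.fillVia (a := a) (e := e) (s := s) (Q := Q) hw ha ha4 fun s' h1 h2 h3 =>
    hQ s' h1 h2 fun x => by rw [h3, h.reg_zero, if_pos x.2]
  rwa [h.reg_zero] at this

theorem Rep.halts_fillVia_cur {Q : State → Prop} (h : Rep G k v O R W l m m' s) {e : BExpr}
    (hw : e.WF 1) (ha : e.Avoids 4) (W' : Finset (Fin n))
    (he : ∀ x : Fin n, e.eval s (fun _ => x) = if x ∈ W' then 1 else 0)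
    (hQ : ∀ s', Rep G k v O R W' l m m' s' → Q s') :
    Halts (fillVia 3 e) s (n * (e.time n + 27) + 12) Q := by
  refine h.halts_fillVia 3 hw ha (by omega) fun s' h1 h2 h3 => hQ s' ?_
  refine h.of_fill h1 3 (by omega) h2 (fun _ => rfl) (fun _ => rfl) (by omega) (fun _ => rfl)
    (by omega) (by omega) (fun _ x => ?_) (by omega)
  rw [h3, he]

/-- A bound for the running time of `grow` if the minimum covers have at most `M` elements. -/
def growTime (n M : ℕ) : ℕ := n * (growE.time n + 27) + 12 + (2 + searchTime n M)

theorem Rep.halts_grow {M : ℕ} (h : Rep G k v O R W l m m' s) (hn : 1 ≤ n)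
    (hG : G.Covers k Finset.univ Finset.univ) (hM : G.coverNumber k (growSet G R W) ≤ M) :
    Halts grow s (growTime n M) fun s' => ∃ l',
      Rep G k v O R (growSet G R W) l' m' (G.coverNumber k (growSet G R W)) s' ∧
      G.Covers k (digitSet n l') (growSet G R W) ∧
      (digitSet n l').card ≤ G.coverNumber k (growSet G R W) := by
  refine Halts.seq (h.halts_fillVia_cur (by simp [growE, WF, andE, notE, nbE, eqE])
    (by simp [growE, Avoids, andE, notE, nbE, eqE]) (growSet G R W) (fun x => ?_) fun s1 r1 => ?_)
  · convert h.eval_growE x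
  refine Halts.seq (T := 2) (Halts.assign ?_)
  simp only [Expr.eval, r1.reg_five]
  exact (r1.setReg_four m').halts_search hn (hG.mono le_rfl (Finset.subset_univ _)) hM

end
end RAM

/-! ### Bounded growth around a vertex -/

namespace RAM

open BExpr

section

variable {n : ℕ} {G : SimpleGraph (Fin n)} {k m m' : ℕ} {O R W : Finset (Fin n)} {l : List ℕ}
  {s : State} {v : Fin n} {c : Fin n → EuclideanSpace ℝ (Fin 2)}

/-- `W` contains `v`, is disjoint from `R` and lies in the disk of radius `2 * j` around `v`. -/
structure Reach (c : Fin n → EuclideanSpace ℝ (Fin 2)) (R : Finset (Fin n)) (v : Fin n) (j : ℕ)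
    (W : Finset (Fin n)) : Prop where
  mem : v ∈ W
  notMem : ∀ x ∈ W, x ∉ R
  dist_le : ∀ x ∈ W, dist (c x) (c v) ≤ 2 * j

theorem Reach.singleton (hv : v ∉ R) : Reach c R v 0 {v} :=
  ⟨by simp, by simpa using hv, by simp⟩

/-- Near vertices are joined through a common closed neighbour, so each growth step moves at most
distance 2. -/
theorem Reach.growSet
    (hc : ∀ u v, G.Adj u v ↔ u ≠ v ∧ c u ∈ Metric.closedBall (c v) 1) {j : ℕ}
    (h : Reach c R v j W) : Reach c R v (j + 1) (growSet G R W) := by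
  have hm (x : Fin n) : x ∈ RAM.growSet G R W ↔ x ∉ R ∧ ∃ w ∈ W, G.Near w x := by
    simp [RAM.growSet]
  refine ⟨(hm v).2 ⟨h.notMem v h.mem, v, h.mem, .refl v⟩, fun x hx => ((hm x).1 hx).1,
    fun x hx => ?_⟩
  obtain ⟨-, w, hw, hn⟩ := (hm x).1 hx
  have h1 := hn.symm.dist_le hc
  have h2 := h.dist_le w hw
  have h3 := dist_triangle (c x) (c w) (c v)
  push_cast; linarith

theorem Reach.coverNumber_le
    (hc : ∀ u v, G.Adj u v ↔ u ≠ v ∧ c u ∈ Metric.closedBall (c v) 1)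
    (hG : G.Covers k Finset.univ Finset.univ) {j J : ℕ} (hj : j ≤ J) (h : Reach c R v j W) :
    G.coverNumber k W ≤ (4 * (2 * J) + 1) ^ 2 * k ^ 2 := by
  refine (hG.mono le_rfl (Finset.subset_univ W)).coverNumber_le_of_dist hc (c v) (2 * J)
    fun x hx => (h.dist_le x hx).trans ?_
  have : (j : ℝ) ≤ J := by exact_mod_cast hj
  push_cast; linarith

/-- The bound for the sizes of the minimum covers computed if there are at most `J` rounds. -/
def coverBound (k J : ℕ) : ℕ := (4 * (2 * (J + 2)) + 1) ^ 2 * k ^ 2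

/-- A bound for the running time of `processVertex`. -/
def vertexTime (q n k J : ℕ) : ℕ :=
  n * (initE.time n + 27) + 12 + (searchTime n (coverBound k J) +
    (growTime n (coverBound k J) + (J * ((growTest q).cost + 1 + growTime n (coverBound k J)) +
      ((growTest q).cost + 1) + (n * (outE.time n + 27) + 12 + (n * (remE.time n + 27) + 12)))))

theorem Rep.halts_processVertex {q J : ℕ} (h : Rep G k v O R W l m m' s)
    (hc : ∀ u v, G.Adj u v ↔ u ≠ v ∧ c u ∈ Metric.closedBall (c v) 1)
    (hG : G.Covers k Finset.univ Finset.univ) (hv : v ∉ R)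
    (hJ : (4 * (2 * J) + 1) ^ 2 * k ^ 2 * q ^ J < (q + 1) ^ J) :
    Halts (processVertex q) s (vertexTime q n k J) fun s' => ∃ W₀ D l m m',
      Rep G k v (O ∪ D) (R ∪ growSet G R W₀) (growSet G R W₀) l m m' s' ∧ v ∈ W₀ ∧
      (∀ x ∈ W₀, x ∉ R) ∧ G.Covers k D (growSet G R W₀) ∧
      q * D.card ≤ (q + 1) * G.coverNumber k W₀ := by
  have hn : 1 ≤ n := v.pos
  -- A loop round starts with `W₀` at level `j < J` and searches level `j + 2`, so the bound for
  -- level `J + 2` is ample.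
  have hM {j : ℕ} {W : Finset (Fin n)} (hr : Reach c R v j W) (hj : j ≤ J + 2) :
      G.coverNumber k W ≤ coverBound k J := hr.coverNumber_le hc hG hj
  have r0 : Reach c R v 0 {v} := .singleton hv
  refine Halts.seq (h.halts_fillVia_cur (by simp [initE, WF, notE, eqE])
    (by simp [initE, Avoids, notE, eqE]) {v} (fun x => ?_) fun s1 r1 => ?_)
  · convert h.eval_initE v.2 x
  refine Halts.seq ((r1.halts_search hn (hG.mono le_rfl (Finset.subset_univ _))
    (hM r0 (by omega))).mono le_rfl ?_)
  rintro s2 ⟨l2, r2, -, -⟩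
  -- One growth step precedes the loop, since the test compares the cover numbers of two consecutive
  -- sets.
  refine Halts.seq ((r2.halts_grow hn hG (hM (r0.growSet hc) (by omega))).mono le_rfl ?_)
  rintro s3 ⟨l3, r3, hcov3, hcard3⟩
  -- `W₀` is the set before the current one. Each continued round multiplies its cover number by at
  -- least `(q + 1) / q`, starting from at least `k` for a single vertex.
  have key := Halts.loop (p := grow) (e := growTest q) (T := growTime n (coverBound k J))
    (I := fun i s => ∃ j W₀ l, j + i = J ∧ Reach c R v j W₀ ∧
      (q + 1) ^ j * k ≤ q ^ j * G.coverNumber k W₀ ∧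
      Rep G k v O R (growSet G R W₀) l (G.coverNumber k W₀) (G.coverNumber k (growSet G R W₀)) s ∧
      G.Covers k (digitSet n l) (growSet G R W₀) ∧
      (digitSet n l).card ≤ G.coverNumber k (growSet G R W₀)) ?_ ?_ J s3
    ⟨0, {v}, l3, by omega, r0, by
      simpa using (hG.mono le_rfl (Finset.subset_univ _)).le_coverNumber
        (Finset.mem_singleton_self v), r3, hcov3, hcard3⟩
  · refine Halts.seq (key.mono le_rfl ?_)
    rintro s4 ⟨⟨-, -, j, W₀, l4, -, hr, -, r4, hcov, hcard⟩, htest⟩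
    simp only [growTest, Expr.eval, eval_mulExpr, r4.reg_four, r4.reg_five] at htest
    -- The truncated difference in the test vanishes exactly when `q γ(W') ≤ (q + 1) γ(W₀)`, where
    -- `W'` is the grown set.
    have hq : q * (digitSet n l4).card ≤ (q + 1) * G.coverNumber k W₀ :=
      (Nat.mul_le_mul_left q hcard).trans (by omega)
    refine Halts.seq (r4.halts_fillVia 1 (by simp [outE, WF, notE, memE, eqE])
      (by simp [outE, Avoids, notE, memE, eqE]) (by omega) fun s5 h1 h2 h3 => ?_)
    have r5 : Rep G k v (O ∪ digitSet n l4) R (growSet G R W₀) l4 (G.coverNumber k W₀)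
        (G.coverNumber k (growSet G R W₀)) s5 := by
      refine r4.of_fill h1 1 (by omega) h2 (by omega) (fun _ => rfl) (fun _ => rfl)
        (fun _ => rfl) (fun _ x => ?_) (by omega) (by omega) (by omega)
      rw [h3]
      convert r4.eval_outE x
    refine r5.halts_fillVia 2 (by simp [remE, WF, notE]) (by simp [remE, Avoids, notE])
      (by omega) fun s6 h1 h2 h3 => ?_
    refine ⟨W₀, digitSet n l4, l4, _, _, r5.of_fill h1 2 (by omega) h2 (fun _ => rfl) (by omega)
      (fun _ => rfl) (fun _ => rfl) (by omega) (fun _ x => ?_) (by omega) (by omega), hr.mem,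
      hr.notMem, hcov, hq⟩
    rw [h3]
    convert r5.eval_remE x
  · rintro s4 ⟨j, W₀, l4, rfl, hr, hgrow, r4, -, -⟩
    rw [add_zero] at hJ
    simp only [growTest, Expr.eval, eval_mulExpr, r4.reg_four, r4.reg_five]
    -- For `k = 0` the growth estimate says nothing, but all cover numbers are 0 and the test fails
    -- anyway. For `k > 0`, level `J` contradicts `hJ`.
    rcases Nat.eq_zero_or_pos k with rfl | hk
    · have := (hr.growSet hc).coverNumber_le hc hG le_rfl
      rw [zero_pow two_ne_zero, mul_zero, Nat.le_zero] at this
      rw [this]; simp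
    · have h1 := Nat.mul_le_mul_left (q ^ j) (hr.coverNumber_le hc hG le_rfl)
      have h2 := Nat.le_mul_of_pos_right ((q + 1) ^ j) hk
      rw [mul_comm (q ^ j) (_ * _)] at h1
      omega
  · rintro i s4 ⟨j, W₀, l4, hij, hr, hgrow, r4, hcov, hcard⟩ htest
    simp only [growTest, Expr.eval, eval_mulExpr, r4.reg_four, r4.reg_five] at htest
    refine (r4.halts_grow hn hG (hM ((hr.growSet hc).growSet hc) (by omega))).mono le_rfl ?_
    rintro s5 ⟨l5, r5, hcov5, hcard5⟩
    refine ⟨j + 1, growSet G R W₀, l5, by omega, hr.growSet hc, ?_, r5, hcov5, hcard5⟩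
    calc (q + 1) ^ (j + 1) * k = (q + 1) * ((q + 1) ^ j * k) := by ring
      _ ≤ (q + 1) * (q ^ j * G.coverNumber k W₀) := Nat.mul_le_mul_left _ hgrow
      _ = q ^ j * ((q + 1) * G.coverNumber k W₀) := by ring
      _ ≤ q ^ j * (q * G.coverNumber k (growSet G R W₀)) := Nat.mul_le_mul_left _ (by omega)
      _ = q ^ (j + 1) * G.coverNumber k (growSet G R W₀) := by ring

/-! ### Accumulating the approximation ratio -/

/-- The output `O` covers the removed vertices `R`, and its size is bounded by the cover number of
a set `X` that is not near to any vertex outside `R`. -/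
def Progress (G : SimpleGraph (Fin n)) (k q : ℕ) (O R : Finset (Fin n)) : Prop :=
  G.Covers k O R ∧ ∃ X : Finset (Fin n), (∀ x ∈ X, ∀ u, u ∉ R → ¬ G.Near x u) ∧
    q * O.card ≤ (q + 1) * G.coverNumber k X

/-- `X` collects the sets before the last growth step. The new `W₀` avoids `R`, so it is not near
`X` and the cover numbers add. Unremoved vertices near `W₀` are exactly those of `growSet G R W₀`,
so afterwards nothing outside the removed set is near `X ∪ W₀`. -/
theorem Progress.union {q : ℕ} {D W₀ : Finset (Fin n)} (h : Progress G k q O R)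
    (hG : G.Covers k Finset.univ Finset.univ) (hR : ∀ x ∈ W₀, x ∉ R)
    (hD : G.Covers k D (growSet G R W₀)) (hq : q * D.card ≤ (q + 1) * G.coverNumber k W₀) :
    Progress G k q (O ∪ D) (R ∪ growSet G R W₀) := by
  obtain ⟨hO, X, hX, hOX⟩ := h
  refine ⟨hO.union hD, X ∪ W₀, fun x hx u hu hn => ?_, ?_⟩
  · rw [Finset.mem_union, not_or] at hu
    rcases Finset.mem_union.1 hx with hx | hx
    · exact hX x hx u hu.1 hn
    · exact hu.2 (by simpa [growSet] using ⟨hu.1, x, hx, hn⟩)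
  · have h1 := (hG.mono le_rfl (Finset.subset_univ (X ∪ W₀))).coverNumber_add_le
      fun x hx u hu => hX x hx u (hR u hu)
    calc q * (O ∪ D).card ≤ q * (O.card + D.card) :=
          Nat.mul_le_mul_left _ (Finset.card_union_le _ _)
      _ = q * O.card + q * D.card := Nat.mul_add _ _ _
      _ ≤ (q + 1) * G.coverNumber k X + (q + 1) * G.coverNumber k W₀ := add_le_add hOX hq
      _ = (q + 1) * (G.coverNumber k X + G.coverNumber k W₀) := (Nat.mul_add _ _ _).symm
      _ ≤ _ := Nat.mul_le_mul_left _ h1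

theorem rep_input (G : SimpleGraph (Fin n)) (k : ℕ) : Rep G k 0 ∅ ∅ ∅ [] 0 0 (input G k) := by
  classical
  refine ⟨by simp [input], by simp [input], by simp [input], by simp [input], by simp [input],
    fun x y => ?_, by simp [input], by simp [input], by simp [input], by simp [input],
    by simp [ValidDigits], by simp⟩
  simp only [input, true_and]
  refine if_congr ⟨?_, fun h => ⟨x, y, by rw [mul_comm], h⟩⟩ rfl rfl
  rintro ⟨u, w, h, huw⟩
  have hn := x.pos
  have h1 : x = u := Fin.ext (by
    have := congrArg (· / n) h
    simpa [Nat.mul_add_div hn, Nat.div_eq_of_lt, mul_comm (u : ℕ)] using this)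
  subst h1
  have h2 : y = w := Fin.ext (by rw [mul_comm] at h; omega)
  exact h2 ▸ huw

theorem Rep.output_eq {v : ℕ} (h : Rep G k v O R W l m m' s) : output n s = O := by
  ext x
  simp only [output, Finset.mem_filter, Finset.mem_univ, true_and, h.out]
  split_ifs <;> simp_all

/-- A bound for the running time of the whole program. -/
def totalTime (q n k J : ℕ) : ℕ :=
  guardE.time n + 2 + (2 + (n * (3 + vertexTime q n k J + 1 + 8) + 6 + 1))

theorem halts_tupleDomination {q J : ℕ} (G : SimpleGraph (Fin n)) (hG : G.IsUnitDiskGraph)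
    (hJ : (4 * (2 * J) + 1) ^ 2 * k ^ 2 * q ^ J < (q + 1) ^ J) :
    Halts (tupleDomination q) (input G k) (totalTime q n k J) fun s =>
      G.Covers k Finset.univ Finset.univ → G.Covers k (output n s) Finset.univ ∧
        q * (output n s).card ≤ (q + 1) * G.coverNumber k Finset.univ := by
  obtain ⟨c, hc⟩ := hG
  have r0 := rep_input G k
  refine Halts.seq (r0.halts_assignB_six (by simp [guardE, WF, notE, nbE, eqE]) fun s1 r1 h6 => ?_)
  have hguard := r0.eval_guardE
  rw [← h6] at hguard
  -- If even the full vertex set is not `k`-tuple dominating, nothing is claimed about the output,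
  -- and stopping at once keeps the search from running forever.
  refine Halts.cond (fun h => (Halts.skip fun hcov => absurd (hguard.2 hcov) h).mono
    (by omega) (fun _ h => h)) fun h => ?_
  have hcov := hguard.1 h
  refine (Halts.forLoop (x := 2) (n := n) (T := 3 + vertexTime q n k J + 1) (I := fun i s =>
    ∃ O R W l m m', Rep G k i O R W l m m' s ∧ Progress G k q O R ∧
      ∀ x : Fin n, (x : ℕ) < i → x ∈ R) ?_ ?_ ?_).mono (by omega) ?_
  · rintro i s ⟨O, R, W, l, m, m', r, -⟩
    exact ⟨r.reg_two, r.reg_zero⟩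
  · refine ⟨∅, ∅, ∅, [], 0, 0, r1.setReg_two 0, ⟨by simp [SimpleGraph.Covers], ∅, by simp, by simp⟩,
      by simp⟩
  · rintro i s hi ⟨O, R, W, l, m, m', r, hp, hR⟩
    have he : (Expr.get 2 (.reg 2)).eval s = if (⟨i, hi⟩ : Fin n) ∈ R then 1 else 0 := by
      simp only [Expr.eval, r.reg_two]
      convert r.rem ⟨i, hi⟩
    have hlt {x : Fin n} (hx : (x : ℕ) < i + 1) : (x : ℕ) < i ∨ x = ⟨i, hi⟩ := by
      rw [Fin.ext_iff]
      exact Nat.lt_succ_iff_lt_or_eq.1 hx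
    refine (Halts.cond (T := vertexTime q n k J + 1) (fun h => ?_) fun h => ?_).mono
      (by simp only [Expr.cost]; omega) (fun _ h => h)
    · have hiR : (⟨i, hi⟩ : Fin n) ∈ R := by by_contra hne; exact h (he.trans (if_neg hne))
      refine (Halts.skip ?_).mono (by omega) (fun _ h => h)
      refine ⟨r.reg_two, O, R, W, l, m, m', r.setReg_two _, hp, fun x hx => ?_⟩
      rcases hlt hx with hx | rfl
      exacts [hR x hx, hiR]
    · have hiR : (⟨i, hi⟩ : Fin n) ∉ R := by
        intro hmem; rw [he, if_pos hmem] at h; exact one_ne_zero h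
      refine (Rep.halts_processVertex (v := ⟨i, hi⟩) r hc hcov hiR hJ).mono (by omega) ?_
      rintro s' ⟨W₀, D, l', m, m', r', hmem, hW, hD, hq⟩
      refine ⟨r'.reg_two, _, _, _, _, _, _, r'.setReg_two _, hp.union hcov hW hD hq,
        fun x hx => Finset.mem_union.2 ?_⟩
      rcases hlt hx with hx | rfl
      · exact .inl (hR x hx)
      · exact .inr (by simpa [growSet] using ⟨hiR, _, hmem, .refl _⟩)
  · rintro s ⟨O, R, W, l, m, m', r, ⟨hO, X, -, hX⟩, hR⟩ -
    rw [r.output_eq]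
    refine ⟨hO.mono le_rfl fun x _ => hR x x.2, hX.trans (Nat.mul_le_mul_left _ ?_)⟩
    obtain ⟨E, hE, hEc⟩ := hcov.exists_card_eq
    exact hEc ▸ SimpleGraph.coverNumber_le (hE.mono le_rfl (Finset.subset_univ X))

end

/-! ### Polynomial bounds -/

/-- `f` is bounded by a polynomial. -/
def PolyBounded (f : ℕ → ℕ) : Prop := ∃ p : Polynomial ℕ, ∀ n, f n ≤ p.eval n

theorem PolyBounded.const (c : ℕ) : PolyBounded fun _ => c := ⟨.C c, by simp⟩

theorem PolyBounded.id : PolyBounded fun n => n := ⟨.X, by simp⟩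

theorem PolyBounded.add {f g : ℕ → ℕ} (hf : PolyBounded f) (hg : PolyBounded g) :
    PolyBounded fun n => f n + g n := by
  obtain ⟨p, hp⟩ := hf
  obtain ⟨r, hr⟩ := hg
  exact ⟨p + r, fun n => by simpa using add_le_add (hp n) (hr n)⟩

theorem PolyBounded.mul {f g : ℕ → ℕ} (hf : PolyBounded f) (hg : PolyBounded g) :
    PolyBounded fun n => f n * g n := by
  obtain ⟨p, hp⟩ := hf
  obtain ⟨r, hr⟩ := hg
  exact ⟨p * r, fun n => by simpa using Nat.mul_le_mul (hp n) (hr n)⟩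

theorem PolyBounded.pow {f : ℕ → ℕ} (hf : PolyBounded f) (c : ℕ) :
    PolyBounded fun n => f n ^ c := by
  obtain ⟨p, hp⟩ := hf
  exact ⟨p ^ c, fun n => by simpa using Nat.pow_le_pow_left (hp n) c⟩

theorem BExpr.polyBounded_time (e : BExpr) : PolyBounded fun n => e.time n := by
  induction e with
  | const _ => exact .const 2
  | reg _ => exact .const 2
  | var _ => exact .const 2
  | get _ e ih => exact ih.add (.const 3)
  | add e f ihe ihf => exact (ihe.add ihf).add (.const 4)
  | sub e f ihe ihf => exact (ihe.add ihf).add (.const 4)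
  | sum _ e ih => exact (PolyBounded.id.mul (ih.add (.const 12))).add (.const 8)

theorem polyBounded_fill (e : BExpr) : PolyBounded fun n => n * (e.time n + 27) + 12 :=
  (PolyBounded.id.mul (e.polyBounded_time.add (.const 27))).add (.const 12)

/-- The exponent `M` is independent of `n`; this is where bounded cover numbers turn into polynomial
time. -/
theorem polyBounded_searchTime (M : ℕ) : PolyBounded fun n => searchTime n M := by
  have hb := badE.polyBounded_time.add (.const 2)
  have hl := lenE.polyBounded_time.add (.const 2)
  have hp := (PolyBounded.id.add (.const 1)).pow M
  have hi := (PolyBounded.id.mul (.const 14)).add (.const 15)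
  exact ((PolyBounded.id.mul (.const 29)).add (.const 12)).add
    (hb.add (((hp.mul ((PolyBounded.const 2).add (hi.add hb))).add (.const 2)).add hl))

theorem polyBounded_totalTime (q k J : ℕ) : PolyBounded fun n => totalTime q n k J := by
  have hs := polyBounded_searchTime (coverBound k J)
  have hg : PolyBounded fun n => growTime n (coverBound k J) :=
    (polyBounded_fill growE).add ((PolyBounded.const 2).add hs)
  have hv : PolyBounded fun n => vertexTime q n k J :=
    (polyBounded_fill initE).add (hs.add (hg.add
      ((((PolyBounded.const J).mul ((PolyBounded.const ((growTest q).cost + 1)).add hg)).add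
        (.const ((growTest q).cost + 1))).add
          ((polyBounded_fill outE).add (polyBounded_fill remE)))))
  exact (guardE.polyBounded_time.add (.const 2)).add ((PolyBounded.const 2).add
    (((PolyBounded.id.mul (((((PolyBounded.const 3).add hv).add (.const 1))).add (.const 8))).add
      (.const 6)).add (.const 1)))

end RAM

theorem mainTheorem2 (ε : ℝ) (hε : 0 < ε) :
    ∃ P : RAM.Prog, ∀ k : ℕ, ∃ p : Polynomial ℕ,
      ∀ (n : ℕ) (G : SimpleGraph (Fin n)), G.IsUnitDiskGraph →
        ∃ (t : ℕ) (s : RAM.State), RAM.Run P (RAM.input G k) t s ∧ t ≤ p.eval n ∧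
          ∀ D : Finset (Fin n), G.IsMinTupleDominating k D →
            G.IsTupleDominating k (RAM.output n s) ∧
              ((RAM.output n s).card : ℝ) ≤ (1 + ε) * (D.card : ℝ) := by
  -- The growth parameter is `q + 1`, giving the ratio `1 + 1 / (q + 1) < 1 + ε`.
  obtain ⟨q, hq⟩ := exists_nat_one_div_lt hε
  refine ⟨RAM.tupleDomination (q + 1), fun k => ?_⟩
  obtain ⟨J, hJ⟩ := SimpleGraph.exists_mul_pow_lt_pow (q + 1) k (by omega)
  obtain ⟨p, hp⟩ := RAM.polyBounded_totalTime (q + 1) k J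
  refine ⟨p, fun n G hG => ?_⟩
  obtain ⟨t, s, hrun, ht, hs⟩ := RAM.halts_tupleDomination G hG hJ
  refine ⟨t, s, hrun, ht.trans (hp n), fun D hD => ?_⟩
  have hcov := SimpleGraph.isTupleDominating_iff_covers.1 hD.1
  obtain ⟨h1, h2⟩ := hs (hcov.mono (Finset.subset_univ D) le_rfl)
  refine ⟨SimpleGraph.isTupleDominating_iff_covers.2 h1, ?_⟩
  have h3 := h2.trans (Nat.mul_le_mul_left _ (SimpleGraph.coverNumber_le hcov))
  have h4 : ((q + 1 : ℝ)) * (RAM.output n s).card ≤ (q + 1 + 1) * D.card := by exact_mod_cast h3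
  have hq0 : (0 : ℝ) < q + 1 := by positivity
  rw [div_lt_iff₀ hq0] at hq
  refine le_of_mul_le_mul_left (h4.trans ?_) hq0
  nlinarith [(Nat.cast_nonneg D.card : (0 : ℝ) ≤ D.card)]
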